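/- Let $\mathcal H$ be a complex Hilbert space, $\mathcal B(\mathcal H)$ its bounded operators, $\mathcal F(\mathcal H)$ the finite rank operators, $\mathcal B_p(\mathcal H)$, $1\le p<\infty$, the Schatten--von Neumann ideals, $\mathcal B_\infty(\mathcal H)$ the compact operators, and $\Phi(\mathcal H)$ the set of bounded Fredholm operators on $\mathcal H$, with index $\operatorname{ind}(T)=\dim\ker T-\dim\ker T^*$. Let $\Omega\subseteq\mathbb C$ be open and connected, let $A:\Omega\to\mathcal B(\mathcal H)$ be analytic with $A(z)\in\Phi(\mathcal H)$ for all $z\in\Omega$, and let $z_0\in\Omega$ be a pole of $A(\cdot)^{-1}$ of order $n_0\in\mathbb N$ (so $n_0\ge1$, $A(z)$ is boundedly invertible for all $z\ne z_0$ near $z_0$, and the Laurent expansion of $A(\cdot)^{-1}$ at $z_0$ begins with a nonzero multiple, in $\mathcal B(\mathcal H)$, of $(z-z_0)^{-n_0}$). Then there exist bounded (not necessarily orthogonal) projections $\widetilde P_j$, $1\le j\le n_0$, in $\mathcal H$, and a map $\widetilde A_{n_0}:\Omega\to\mathcal B(\mathcal H)$, such that, with $\widetilde Q_j=I_{\mathcal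 H}-\widetilde P_j$ and $\widetilde p_j=\dim(\operatorname{ran}\widetilde P_j)$, $$A(z)=\widetilde A_{n_0}(z)\,[\widetilde Q_{n_0}-(z-z_0)\widetilde P_{n_0}]\cdots[\widetilde Q_2-(z-z_0)\widetilde P_2]\,[\widetilde Q_1-(z-z_0)\widetilde P_1],\qquad z\in\Omega,$$ $$1\le\widetilde p_{n_0}\le\widetilde p_{n_0-1}\le\cdots\le\widetilde p_1<\infty,$$ and: 1. $\widetilde A_{n_0}(\cdot)$ is analytic on $\Omega$ and $\widetilde A_{n_0}(z)\in\Phi(\mathcal H)$ for all $z\in\Omega$; for all $z$ sufficiently close to $z_0$ (including $z=z_0$), $\operatorname{ind}(A(z))=\operatorname{ind}(\widetilde A_{n_0}(z))=0$ and $\widetilde A_{n_0}(z)^{-1}\in\mathcal B(\mathcal H)$. 2. $\widetilde p_1=\dim\ker(A(z_0))$. 3. The number $\widetilde\nu:=\sum_{j=1}^{n_0}\widetilde p_j$ satisfies $\widetilde\nu\ge\dim\ker(A(z_0))$ and $\widetilde\nu\ge n_0$. Moreover, $\widetilde\nu=\nu(z_0;A(\cdot))$ whenever $0$ is an isolated point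 of $\sigma(A(z_0))$, where $\nu(z_0;A(\cdot))$ is defined as follows: choose any $\varepsilon>0$ such that $\sigma(A(z_0))\cap\{|\zeta|\le\varepsilon\}\subseteq\{0\}$ and, for $z$ near $z_0$, put $$P(z)=\frac{-1}{2\pi i}\oint_{|\zeta|=\varepsilon}(A(z)-\zeta I_{\mathcal H})^{-1}\,d\zeta,\qquad T(z)=P(z_0)P(z)+[I_{\mathcal H}-P(z_0)][I_{\mathcal H}-P(z)];$$ let $F(z)$ be the block of $T(z)A(z)T(z)^{-1}$ acting in $P(z_0)\mathcal H$; then $\nu(z_0;A(\cdot))$ is the order of the zero at $z_0$ of $\det_{P(z_0)\mathcal H}(F(\cdot))$. 4. For every $z\in\Omega$: $I_{\mathcal H}-A(z)\in\mathcal F(\mathcal H)$ if and only if $I_{\mathcal H}-\widetilde A_{n_0}(z)\in\mathcal F(\mathcal H)$; and, for every $1\le p\le\infty$, $I_{\mathcal H}-A(z)\in\mathcal B_p(\mathcal H)$ if and only if $I_{\mathcal H}-\widetilde A_{n_0}(z)\in\mathcal B_p(\mathcal H)$. -/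

import Mathlib

open Filter Topology

namespace HowlandFactorization

noncomputable section

/-- The index `dim ker T - dim ker T*` of a Fredholm operator `T` on a Hilbert space. -/
def fredholmIndex {H : Type*} [NormedAddCommGroup H] [InnerProductSpace ℂ H] [CompleteSpace H]
    (T : H →L[ℂ] H) : ℤ :=
  (Module.finrank ℂ (LinearMap.ker (T : H →ₗ[ℂ] H)) : ℤ)
    - (Module.finrank ℂ
        (LinearMap.ker ((ContinuousLinearMap.adjoint T : H →L[ℂ] H) : H →ₗ[ℂ] H)) : ℤ)

/-- `z₀` is a pole of order `n` of `z ↦ A(z)⁻¹`: the operators `A(z)` are boundedly invertible on a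
punctured neighbourhood of `z₀`, and there `A(z)⁻¹ = (z - z₀)⁻ⁿ g(z)` with `g` analytic at `z₀` and
`g(z₀) ≠ 0`. (`Ring.inverse T` is the bounded inverse of `T` whenever `T` has one.) -/
def InverseHasPole {H : Type*} [NormedAddCommGroup H] [InnerProductSpace ℂ H]
    (A : ℂ → H →L[ℂ] H) (z₀ : ℂ) (n : ℕ) : Prop :=
  0 < n ∧ (∀ᶠ z in 𝓝[≠] z₀, IsUnit (A z)) ∧
    MeromorphicAt (fun z => Ring.inverse (A z)) z₀ ∧
    meromorphicOrderAt (fun z => Ring.inverse (A z)) z₀ = ((-(n : ℤ) : ℤ) : WithTop ℤ)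

/-- The elementary factor `Q - w P`, where `Q = I - P`. -/
def factor {H : Type*} [NormedAddCommGroup H] [InnerProductSpace ℂ H]
    (P : H →L[ℂ] H) (w : ℂ) : H →L[ℂ] H :=
  (1 - P) - w • P

/-- The ordered product `[Qₙ - w Pₙ] ⋯ [Q₂ - w P₂] [Q₁ - w P₁]` (with `P₁ = P 0`, `P₂ = P 1`, …):
the factor with the smallest index stands on the right. -/
def reversedProduct {H : Type*} [NormedAddCommGroup H] [InnerProductSpace ℂ H]
    {n : ℕ} (P : Fin n → H →L[ℂ] H) (w : ℂ) : H →L[ℂ] H :=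
  (List.ofFn fun j => factor (P j) w).reverse.prod

/-- The dimension of the range of an operator. -/
def rangeDim {H : Type*} [NormedAddCommGroup H] [InnerProductSpace ℂ H] (T : H →L[ℂ] H) : ℕ :=
  Module.finrank ℂ (LinearMap.range (T : H →ₗ[ℂ] H))

/-- The operators of finite rank. -/
def IsFiniteRank {H : Type*} [NormedAddCommGroup H] [InnerProductSpace ℂ H]
    (T : H →L[ℂ] H) : Prop :=
  FiniteDimensional ℂ (LinearMap.range (T : H →ₗ[ℂ] H))

/-- The singular numbers of a bounded operator on a Hilbert space, numbered from `0`: `s_n(T)` is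
the distance in operator norm from `T` to the operators of rank at most `n`. For compact `T` they
are the eigenvalues of `|T| = (T* T)^{1/2}`, in decreasing order and with multiplicity, followed by
zeros if there are only finitely many nonzero ones. -/
def singularNumber {H : Type*} [NormedAddCommGroup H] [InnerProductSpace ℂ H]
    (T : H →L[ℂ] H) (n : ℕ) : ℝ :=
  sInf {r : ℝ | ∃ F : H →L[ℂ] H, (F : H →ₗ[ℂ] H).rank ≤ (n : Cardinal) ∧ r = ‖T - F‖}

/-- The Schatten-von Neumann ideals, `1 ≤ p ≤ ∞`: compact operators with `p`-summable singular
numbers for `p < ∞`, all compact operators for `p = ∞`. -/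
def IsSchatten {H : Type*} [NormedAddCommGroup H] [InnerProductSpace ℂ H]
    (p : ENNReal) (T : H →L[ℂ] H) : Prop :=
  IsCompactOperator T ∧ (p ≠ ⊤ → Summable fun n => singularNumber T n ^ p.toReal)

/-- The Riesz projection `(-1 / 2πi) ∮_{|ζ| = ε} (T - ζ I)⁻¹ dζ`; Mathlib's resolvent is
`(ζ I - T)⁻¹`, which absorbs the minus sign. -/
def rieszProjection {H : Type*} [NormedAddCommGroup H] [InnerProductSpace ℂ H]
    (T : H →L[ℂ] H) (ε : ℝ) : H →L[ℂ] H :=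
  (2 * (Real.pi : ℂ) * Complex.I)⁻¹ • circleIntegral (fun ζ => resolvent T ζ) 0 ε

/-- The transformation `T(z) = P(z₀) P(z) + [I - P(z₀)] [I - P(z)]` built from the Riesz
projections `P(z)` of `A(z)`. -/
def wolfTransform {H : Type*} [NormedAddCommGroup H] [InnerProductSpace ℂ H]
    (A : ℂ → H →L[ℂ] H) (z₀ : ℂ) (ε : ℝ) (z : ℂ) : H →L[ℂ] H :=
  rieszProjection (A z₀) ε * rieszProjection (A z) ε
    + (1 - rieszProjection (A z₀) ε) * (1 - rieszProjection (A z) ε)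

/-- The upper left block `F(z)` of `T(z) A(z) T(z)⁻¹` with respect to
`H = P(z₀) H ∔ [I - P(z₀)] H`. -/
def howlandBlock {H : Type*} [NormedAddCommGroup H] [InnerProductSpace ℂ H]
    (A : ℂ → H →L[ℂ] H) (z₀ : ℂ) (ε : ℝ) (z : ℂ) :
    LinearMap.range (rieszProjection (A z₀) ε : H →ₗ[ℂ] H) →ₗ[ℂ]
      LinearMap.range (rieszProjection (A z₀) ε : H →ₗ[ℂ] H) :=
  (rieszProjection (A z₀) ε : H →ₗ[ℂ] H).rangeRestrict ∘ₗ
    ((wolfTransform A z₀ ε z * A z * Ring.inverse (wolfTransform A z₀ ε z) : H →L[ℂ] H) :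
      H →ₗ[ℂ] H) ∘ₗ
    (LinearMap.range (rieszProjection (A z₀) ε : H →ₗ[ℂ] H)).subtype

/-- The multiplicity `ν(z₀; A(·))`: the order of the zero of `det F(z)` at `z₀`, where the
determinant is taken on `P(z₀) H`; it is `⊤` if `det F` vanishes identically near `z₀`. Here `ε` is
the radius of a circle around `0` that separates `0` from the rest of the spectrum of `A(z₀)`. -/
def howlandMultiplicity {H : Type*} [NormedAddCommGroup H] [InnerProductSpace ℂ H]
    (A : ℂ → H →L[ℂ] H) (z₀ : ℂ) (ε : ℝ) : ℕ∞ :=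
  analyticOrderAt (fun z => LinearMap.det (howlandBlock A z₀ ε z)) z₀

end

end HowlandFactorization

/-!
# Factorization of an analytic Fredholm family at a pole of its inverse

Write `w = z - z₀`. If `P` is a projection onto `ker A(z₀)` and `Q = 1 - P`, then `A(z) P` vanishes at
`z₀`, so `B(z) = A(z) (Q - w⁻¹ P)` extends analytically to `z₀` (`peel`), and `A = B (Q - w P)` since
`Q - w⁻¹ P` is the inverse of `Q - w P`. As `A(z) A(z)⁻¹ = 1`, the leading Laurent coefficient of
`A⁻¹` has its range in `ker A(z₀)` and is annihilated by `Q`; therefore `B⁻¹ = (Q - w P) A⁻¹` has a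
pole of order exactly one less (`HasInverseOrder.peel`). After `n₀` steps the inverse is analytic and
the remaining factor is invertible at `z₀` (`exists_factorization`). The ranks decrease because `P`
is injective on `ker B(z₀)`. The remaining factor differs from `A` by operators of finite rank,
which gives the Fredholm property, the index, and the trace ideal statements.

The multiplicity does not need the logarithmic residue. The sum of the ranks of the successive
projections (`HasMultiplicity`) is an invariant of the equivalence `A = E A' G` with `E`, `G` analytic
and invertible at `z₀`: if two equivalent families are divided by the elementary factors of their
kernels, then the quotients are again equivalent, because `(Q' - w P') G (Q - w⁻¹ P)` and its inverse
have removable singularities (`LocallyEquivalent.of_factor`). By means of the Riesz projections, `A`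
is equivalent to the family that acts as `F(z)` on the finite-dimensional space `ran P(z₀)` and as
the identity on a complement (`howlandMultiplicity_eq`). For such a family every elementary factor
acts in that space and has determinant `(-w)ᵖ` there, so the sum of the ranks is the order of the
zero of `det F` (`HasMultiplicity.analyticOrderAt_det`).

For the Riesz projection of `T` the following is proved: it is idempotent, `T` is invertible on the
complementary subspace, its rank is finite if `T` is Fredholm (`isFiniteRank_rieszProjection`), and
it is analytic in `z` along an analytic family `T = A(z)` (`analyticAt_rieszProjection`).
-/

namespace HowlandFactorization

/-! ### Operators of finite rank -/

section FiniteRank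

variable {H : Type*} [NormedAddCommGroup H] [InnerProductSpace ℂ H]

lemma isFiniteRank_iff_hasFiniteRange {T : H →L[ℂ] H} :
    IsFiniteRank T ↔ (T : H →ₗ[ℂ] H).HasFiniteRange :=
  Module.Finite.iff_fg

lemma IsFiniteRank.add {S T : H →L[ℂ] H} (hS : IsFiniteRank S) (hT : IsFiniteRank T) :
    IsFiniteRank (S + T) := by
  rw [isFiniteRank_iff_hasFiniteRange] at *
  exact LinearMap.HasFiniteRange.add hS hT

lemma IsFiniteRank.neg {T : H →L[ℂ] H} (hT : IsFiniteRank T) : IsFiniteRank (-T) := by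
  rw [isFiniteRank_iff_hasFiniteRange] at *
  exact LinearMap.HasFiniteRange.neg hT

lemma IsFiniteRank.sub {S T : H →L[ℂ] H} (hS : IsFiniteRank S) (hT : IsFiniteRank T) :
    IsFiniteRank (S - T) := by
  rw [isFiniteRank_iff_hasFiniteRange] at *
  exact LinearMap.HasFiniteRange.sub hS hT

lemma IsFiniteRank.mul_left {T : H →L[ℂ] H} (hT : IsFiniteRank T) (S : H →L[ℂ] H) :
    IsFiniteRank (S * T) := by
  rw [isFiniteRank_iff_hasFiniteRange] at *
  exact LinearMap.HasFiniteRange.comp_left hT _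

lemma IsFiniteRank.mul_right {T : H →L[ℂ] H} (hT : IsFiniteRank T) (S : H →L[ℂ] H) :
    IsFiniteRank (T * S) := by
  rw [isFiniteRank_iff_hasFiniteRange] at *
  exact LinearMap.HasFiniteRange.comp_right hT _

lemma isFiniteRank_zero : IsFiniteRank (0 : H →L[ℂ] H) := by
  rw [isFiniteRank_iff_hasFiniteRange]
  exact LinearMap.HasFiniteRange.zero

lemma IsFiniteRank.of_isFiniteRank_sub {S T : H →L[ℂ] H} (hS : IsFiniteRank S)
    (hST : IsFiniteRank (S - T)) : IsFiniteRank T := by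
  simpa using hS.sub hST

lemma IsFiniteRank.isCompactOperator {T : H →L[ℂ] H} (hT : IsFiniteRank T) :
    IsCompactOperator T := by
  have : FiniteDimensional ℂ (LinearMap.range (T : H →ₗ[ℂ] H)) := hT
  let T' : H →L[ℂ] LinearMap.range (T : H →ₗ[ℂ] H) :=
    T.codRestrict _ fun x => LinearMap.mem_range_self _ x
  have h : IsCompactOperator (id : LinearMap.range (T : H →ₗ[ℂ] H) → _) :=
    isCompactOperator_id_iff_finiteDimensional (𝕜 := ℂ).2 inferInstance
  exact (h.comp_clm T').clm_comp (Submodule.subtypeL (LinearMap.range (T : H →ₗ[ℂ] H)))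

open LinearMap.FiniteRangeSetoid in
/-- Fredholm operators are stable under perturbations of finite rank. -/
lemma isFredholm_of_isFiniteRank_sub {S T : H →L[ℂ] H} (hS : S.IsFredholm)
    (hST : IsFiniteRank (S - T)) : T.IsFredholm := by
  obtain ⟨v, hv⟩ := hS.exists_isQuasiInverse
  refine ContinuousLinearMap.IsFredholm.of_isQuasiInverse (v := v) ?_
  refine LinearMap.IsQuasiInverse.congr hv (Setoid.refl _) (Setoid.symm ?_)
  rw [LinearMap.FiniteRangeSetoid.equiv_iff_hasFiniteRange]
  exact isFiniteRank_iff_hasFiniteRange.1 hST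

end FiniteRank

/-! ### Schatten classes under finite rank perturbations -/

section Schatten

variable {H : Type*} [NormedAddCommGroup H] [InnerProductSpace ℂ H]

lemma singularNumber_nonneg (T : H →L[ℂ] H) (n : ℕ) : 0 ≤ singularNumber T n := by
  apply Real.sInf_nonneg
  rintro r ⟨F, -, rfl⟩
  exact norm_nonneg _

/-- A perturbation of rank at most `k` shifts the singular numbers by at most `k` places. -/
lemma singularNumber_add_le (T F : H →L[ℂ] H) (k n : ℕ)
    (hF : (F : H →ₗ[ℂ] H).rank ≤ (k : Cardinal)) :
    singularNumber (T + F) (n + k) ≤ singularNumber T n := by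
  refine le_csInf ⟨‖T - 0‖, 0, ?_, rfl⟩ ?_
  · simp
  · rintro r ⟨G, hG, rfl⟩
    refine csInf_le ⟨0, ?_⟩ ⟨G + F, ?_, ?_⟩
    · rintro r ⟨F, -, rfl⟩
      exact norm_nonneg _
    · refine (LinearMap.rank_add_le _ _).trans ?_
      push_cast
      exact add_le_add hG hF
    · congr 1
      abel

lemma IsSchatten.add_isFiniteRank {p : ENNReal} {T F : H →L[ℂ] H}
    (hT : IsSchatten p T) (hF : IsFiniteRank F) : IsSchatten p (T + F) := by
  refine ⟨hT.1.add hF.isCompactOperator, fun hp' => ?_⟩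
  have : FiniteDimensional ℂ (LinearMap.range (F : H →ₗ[ℂ] H)) := hF
  set k := Module.finrank ℂ (LinearMap.range (F : H →ₗ[ℂ] H)) with hk
  have hrank : (F : H →ₗ[ℂ] H).rank ≤ (k : Cardinal) := by
    rw [LinearMap.rank, hk, Module.finrank_eq_rank]
  rw [← summable_nat_add_iff k]
  refine Summable.of_nonneg_of_le (fun n => Real.rpow_nonneg (singularNumber_nonneg _ _) _)
    (fun n => ?_) (hT.2 hp')
  exact Real.rpow_le_rpow (singularNumber_nonneg _ _) (singularNumber_add_le T F k n hrank)
    ENNReal.toReal_nonneg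

lemma isSchatten_iff_of_isFiniteRank_sub {p : ENNReal} {S T : H →L[ℂ] H}
    (hST : IsFiniteRank (S - T)) : IsSchatten p S ↔ IsSchatten p T := by
  constructor
  · intro h
    simpa using h.add_isFiniteRank hST.neg
  · intro h
    simpa using h.add_isFiniteRank hST

end Schatten

/-! ### The index of a finite rank perturbation of an invertible operator -/

section Index

variable {H : Type*} [NormedAddCommGroup H] [InnerProductSpace ℂ H] [CompleteSpace H]

lemma IsFiniteRank.adjoint {T : H →L[ℂ] H} (hT : IsFiniteRank T) :
    IsFiniteRank (ContinuousLinearMap.adjoint T) := by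
  have : FiniteDimensional ℂ (LinearMap.range (T : H →ₗ[ℂ] H)) := hT
  set M := LinearMap.range (T : H →ₗ[ℂ] H)
  -- `T = π T` with `π` the orthogonal projection onto the range of `T`, so `T* = T* π`.
  have h : M.starProjection * T = T := by
    ext x
    exact Submodule.starProjection_eq_self_iff.2 (LinearMap.mem_range_self (T : H →ₗ[ℂ] H) x)
  have h' : ContinuousLinearMap.adjoint T = ContinuousLinearMap.adjoint T * M.starProjection := by
    have := congrArg star h
    rw [star_mul, isSelfAdjoint_starProjection M] at this
    exact this.symm
  rw [h']
  refine IsFiniteRank.mul_left ?_ _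
  rw [IsFiniteRank]
  refine Submodule.finiteDimensional_of_le (S₂ := M) ?_
  rintro _ ⟨x, rfl⟩
  exact Submodule.starProjection_apply_mem M x

/-- For a finite rank perturbation `U + K` of an invertible operator the kernel of the adjoint is
no larger than the kernel: modulo `ran (U + K)` every vector is congruent to one of `ran K`, and
`U + K` maps `U⁻¹ (ran K)` into `ran K`. -/
lemma finrank_ker_adjoint_le {A U : H →L[ℂ] H} (hU : IsUnit U) (hAU : IsFiniteRank (A - U)) :
    Module.finrank ℂ (LinearMap.ker
        ((ContinuousLinearMap.adjoint A : H →L[ℂ] H) : H →ₗ[ℂ] H)) ≤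
      Module.finrank ℂ (LinearMap.ker (A : H →ₗ[ℂ] H)) := by
  obtain ⟨u, rfl⟩ := hU
  have huv : ∀ x, (u : H →L[ℂ] H) ((↑u⁻¹ : H →L[ℂ] H) x) = x := fun x => by
    rw [← mul_apply_eq_comp, Units.mul_inv]; rfl
  have hvu : ∀ x, (↑u⁻¹ : H →L[ℂ] H) ((u : H →L[ℂ] H) x) = x := fun x => by
    rw [← mul_apply_eq_comp, Units.inv_mul]; rfl
  let e : H ≃ₗ[ℂ] H := LinearEquiv.ofLinearMap ((u : H →L[ℂ] H) : H →ₗ[ℂ] H)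
    ((↑u⁻¹ : H →L[ℂ] H) : H →ₗ[ℂ] H) (LinearMap.ext huv) (LinearMap.ext hvu)
  set K := A - (u : H →L[ℂ] H) with hK
  have hA : ∀ x, A x = e x + K x := fun x => by simp [hK, e]
  have : FiniteDimensional ℂ (LinearMap.range (K : H →ₗ[ℂ] H)) := hAU
  set M := LinearMap.range (K : H →ₗ[ℂ] H) with hM
  set M' := M.map (e.symm : H →ₗ[ℂ] H) with hM'
  have hMM' : Module.finrank ℂ M' = Module.finrank ℂ M := LinearEquiv.finrank_map_eq e.symm M
  set W := LinearMap.ker ((ContinuousLinearMap.adjoint A : H →L[ℂ] H) : H →ₗ[ℂ] H) with hW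
  have hWA : W = (LinearMap.range (A : H →ₗ[ℂ] H))ᗮ := (ContinuousLinearMap.orthogonal_range A).symm
  have hWc : IsClosed (W : Set H) := by
    rw [hWA]; exact Submodule.isClosed_orthogonal _
  have : CompleteSpace W := hWc.completeSpace_coe
  let φ : M →ₗ[ℂ] W := (W.orthogonalProjectionOnto : H →ₗ[ℂ] W) ∘ₗ M.subtype
  have hproj : ∀ x, W.orthogonalProjectionOnto (A x) = 0 := by
    intro x
    rw [Submodule.orthogonalProjectionOnto_eq_zero_iff, hWA]
    exact Submodule.le_orthogonal_orthogonal _ (LinearMap.mem_range_self _ x)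
  have hφ : Function.Surjective φ := by
    rintro ⟨w, hw⟩
    refine ⟨⟨-K (e.symm w), neg_mem (LinearMap.mem_range_self _ _)⟩, ?_⟩
    have h1 := hproj (e.symm w)
    rw [hA, e.apply_symm_apply, map_add] at h1
    have h2 : W.orthogonalProjectionOnto w = ⟨w, hw⟩ :=
      Submodule.orthogonalProjectionOnto_mem_subspace_eq_self (⟨w, hw⟩ : W)
    show W.orthogonalProjectionOnto (-K (e.symm w)) = _
    rw [map_neg, ← h2, eq_comm, ← sub_eq_zero, sub_neg_eq_add, h1]
  have hAM : ∀ x ∈ M', (A : H →ₗ[ℂ] H) x ∈ M := by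
    rintro _ ⟨y, hy, rfl⟩
    show A (e.symm y) ∈ M
    rw [hA, e.apply_symm_apply]
    exact add_mem hy (LinearMap.mem_range_self _ _)
  let ψ : M' →ₗ[ℂ] M := (A : H →ₗ[ℂ] H).restrict hAM
  have hφψ : LinearMap.range ψ ≤ LinearMap.ker φ := by
    rintro _ ⟨x, rfl⟩
    exact hproj x
  have h1 := LinearMap.finrank_range_add_finrank_ker φ
  have h2 := LinearMap.finrank_range_add_finrank_ker ψ
  have h3 := Submodule.finrank_mono hφψ
  rw [LinearMap.range_eq_top.2 hφ, finrank_top] at h1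
  have hker : LinearMap.ker (A : H →ₗ[ℂ] H) ≤ M' := by
    intro x hx
    have hx' : A x = 0 := hx
    refine ⟨e x, ?_, by simp⟩
    rw [hA] at hx'
    rw [eq_neg_of_add_eq_zero_left hx']
    exact neg_mem (LinearMap.mem_range_self _ _)
  have : FiniteDimensional ℂ (LinearMap.ker (A : H →ₗ[ℂ] H)) :=
    Submodule.finiteDimensional_of_le hker
  have h4 : Module.finrank ℂ (LinearMap.ker ψ) ≤
      Module.finrank ℂ (LinearMap.ker (A : H →ₗ[ℂ] H)) := by
    refine LinearMap.finrank_le_finrank_of_injective (f := ((M'.subtype ∘ₗ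
      (LinearMap.ker ψ).subtype).codRestrict _ fun x => ?_)) ?_
    · exact congrArg Subtype.val x.2
    · intro x y hxy
      have hxy' : ((x : M') : H) = ((y : M') : H) :=
        congrArg (Subtype.val : LinearMap.ker (A : H →ₗ[ℂ] H) → H) hxy
      exact Subtype.ext (Subtype.ext hxy')
  omega

/-- A finite rank perturbation of an invertible operator has index zero. -/
lemma fredholmIndex_eq_zero {A U : H →L[ℂ] H} (hU : IsUnit U) (hAU : IsFiniteRank (A - U)) :
    fredholmIndex A = 0 := by
  have h1 := finrank_ker_adjoint_le hU hAU
  have h2 := finrank_ker_adjoint_le (A := ContinuousLinearMap.adjoint A)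
    (U := ContinuousLinearMap.adjoint U) (IsUnit.star hU) (by rw [← map_sub]; exact hAU.adjoint)
  rw [ContinuousLinearMap.adjoint_adjoint] at h2
  rw [fredholmIndex]
  omega

end Index

/-! ### Elementary factors -/

section Factor

variable {H : Type*} [NormedAddCommGroup H] [InnerProductSpace ℂ H]

lemma factor_mul_factor {P : H →L[ℂ] H} (hP : IsIdempotentElem P) (v w : ℂ) :
    factor P v * factor P w = 1 - P + (v * w) • P := by
  have hP' : P * P = P := hP
  simp only [factor, sub_mul, mul_sub, one_mul, mul_one, smul_mul_assoc, mul_smul_comm, hP',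
    sub_self, zero_sub]
  module

lemma factor_mul_factor_inv {P : H →L[ℂ] H} (hP : IsIdempotentElem P) {w : ℂ} (hw : w ≠ 0) :
    factor P w * factor P w⁻¹ = 1 := by
  rw [factor_mul_factor hP, mul_inv_cancel₀ hw]
  simp

lemma factor_inv_mul_factor {P : H →L[ℂ] H} (hP : IsIdempotentElem P) {w : ℂ} (hw : w ≠ 0) :
    factor P w⁻¹ * factor P w = 1 := by
  rw [factor_mul_factor hP, inv_mul_cancel₀ hw]
  simp

lemma reversedProduct_cons {n : ℕ} (P : H →L[ℂ] H) (Ps : Fin n → H →L[ℂ] H) (w : ℂ) :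
    reversedProduct (Fin.cons P Ps : Fin (n + 1) → H →L[ℂ] H) w =
      reversedProduct Ps w * factor P w := by
  simp [reversedProduct, List.ofFn_succ]

lemma mul_eq_zero_of_range_eq_ker {P S : H →L[ℂ] H}
    (h : LinearMap.range (P : H →ₗ[ℂ] H) = LinearMap.ker (S : H →ₗ[ℂ] H)) : S * P = 0 := by
  ext x
  have : P x ∈ LinearMap.ker (S : H →ₗ[ℂ] H) := h ▸ LinearMap.mem_range_self _ x
  exact this

lemma mul_eq_of_range_eq_ker {P S T : H →L[ℂ] H} (hP : IsIdempotentElem P)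
    (h : LinearMap.range (P : H →ₗ[ℂ] H) = LinearMap.ker (S : H →ₗ[ℂ] H)) (hT : S * T = 0) :
    P * T = T := by
  ext x
  have : T x ∈ LinearMap.range (P : H →ₗ[ℂ] H) := by
    rw [h]
    exact congrArg (fun R : H →L[ℂ] H => R x) hT
  obtain ⟨y, hy⟩ := this
  have hy' : P y = T x := hy
  rw [mul_apply_eq_comp, ← hy']
  exact congrArg (fun R : H →L[ℂ] H => R y) hP

end Factor

/-! ### Difference quotients of analytic functions -/

section Removable

variable {E : Type*} [NormedAddCommGroup E] [NormedSpace ℂ E] [CompleteSpace E]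

lemma analyticOnNhd_dslope {f : ℂ → E} {Ω : Set ℂ} (hΩ : IsOpen Ω) (hf : AnalyticOnNhd ℂ f Ω)
    {z₀ : ℂ} (hz₀ : z₀ ∈ Ω) : AnalyticOnNhd ℂ (dslope f z₀) Ω :=
  ((Complex.differentiableOn_dslope (hΩ.mem_nhds hz₀)).2 hf.differentiableOn).analyticOnNhd hΩ

lemma analyticAt_dslope {f : ℂ → E} {z₀ : ℂ} (hf : AnalyticAt ℂ f z₀) :
    AnalyticAt ℂ (dslope f z₀) z₀ := by
  obtain ⟨r, hr, h⟩ := hf.exists_ball_analyticOnNhd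
  exact analyticOnNhd_dslope Metric.isOpen_ball h (Metric.mem_ball_self hr) z₀
    (Metric.mem_ball_self hr)

omit [NormedSpace ℂ E] [CompleteSpace E] in
lemma eventuallyEq_nhds_of_nhdsNE {f g : ℂ → E} {z₀ : ℂ} (hf : ContinuousAt f z₀)
    (hg : ContinuousAt g z₀) (h : ∀ᶠ z in 𝓝[≠] z₀, f z = g z) : ∀ᶠ z in 𝓝 z₀, f z = g z :=
  (hf.eventuallyEq_nhds_iff_eventuallyEq_nhdsNE hg).1 h

lemma eventually_ne_nhdsNE (z₀ : ℂ) : ∀ᶠ z in 𝓝[≠] z₀, z - z₀ ≠ 0 := by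
  filter_upwards [self_mem_nhdsWithin] with z hz
  exact sub_ne_zero.2 hz

end Removable

/-! ### Division by an elementary factor -/

section Peel

variable {H : Type*} [NormedAddCommGroup H] [InnerProductSpace ℂ H]

/-- The quotient of `A(z)` by the elementary factor `Q - (z - z₀) P` on the right, when
`A(z₀) P = 0`; the difference quotient makes sense at `z₀` too. -/
noncomputable def peel (A : ℂ → H →L[ℂ] H) (z₀ : ℂ) (P : H →L[ℂ] H) (z : ℂ) : H →L[ℂ] H :=
  A z * (1 - P) - dslope A z₀ z * P

variable {A : ℂ → H →L[ℂ] H} {z₀ : ℂ} {P : H →L[ℂ] H}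

lemma sub_smul_dslope_mul (h0 : A z₀ * P = 0) (z : ℂ) :
    (z - z₀) • (dslope A z₀ z * P) = A z * P := by
  rw [← smul_mul_assoc, sub_smul_dslope, sub_mul, h0, sub_zero]

lemma peel_mul_factor (hP : IsIdempotentElem P) (h0 : A z₀ * P = 0) (z : ℂ) :
    peel A z₀ P z * factor P (z - z₀) = A z := by
  have hP' : P * P = P := hP
  have h1 : (1 - P) * factor P (z - z₀) = 1 - P := by
    simp only [factor, mul_sub, sub_mul, one_mul, mul_one, hP', mul_smul_comm]; simp
  have h2 : P * factor P (z - z₀) = -((z - z₀) • P) := by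
    simp only [factor, mul_sub, mul_one, hP', mul_smul_comm]; simp
  rw [peel, sub_mul, mul_assoc, h1, mul_assoc, h2, mul_neg, mul_smul_comm,
    sub_smul_dslope_mul h0, mul_sub, mul_one]
  abel

lemma isFiniteRank_sub_peel (hPf : IsFiniteRank P) (z : ℂ) : IsFiniteRank (A z - peel A z₀ P z) := by
  have : A z - peel A z₀ P z = (A z + dslope A z₀ z) * P := by
    rw [peel, mul_sub, mul_one, add_mul]; abel
  rw [this]
  exact hPf.mul_left _

variable [CompleteSpace H]

lemma analyticOnNhd_peel {Ω : Set ℂ} (hΩ : IsOpen Ω) (hA : AnalyticOnNhd ℂ A Ω) (hz₀ : z₀ ∈ Ω)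
    (P : H →L[ℂ] H) : AnalyticOnNhd ℂ (peel A z₀ P) Ω := fun z hz =>
  ((hA z hz).mul analyticAt_const).sub
    ((analyticOnNhd_dslope hΩ hA hz₀ z hz).mul analyticAt_const)

lemma analyticAt_peel (hA : AnalyticAt ℂ A z₀) (P : H →L[ℂ] H) :
    AnalyticAt ℂ (peel A z₀ P) z₀ :=
  (hA.mul analyticAt_const).sub ((analyticAt_dslope hA).mul analyticAt_const)

end Peel

/-! ### The order of the pole of the inverse -/

section Pole

variable {H : Type*} [NormedAddCommGroup H] [InnerProductSpace ℂ H]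

/-- `A(z)⁻¹ = (z - z₀)⁻ⁿ g(z)` near `z₀` with `g` analytic at `z₀` and `g(z₀) ≠ 0`, written without
division. For `n = 0` it entails that `A(z₀)` is invertible. -/
def HasInverseOrder (A : ℂ → H →L[ℂ] H) (z₀ : ℂ) (n : ℕ) : Prop :=
  ∃ g : ℂ → H →L[ℂ] H, AnalyticAt ℂ g z₀ ∧ g z₀ ≠ 0 ∧
    (∀ᶠ z in 𝓝 z₀, A z * g z = (z - z₀) ^ n • 1) ∧ ∀ᶠ z in 𝓝 z₀, g z * A z = (z - z₀) ^ n • 1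

lemma continuousAt_sub_pow_smul_one (z₀ : ℂ) (n : ℕ) :
    ContinuousAt (fun z : ℂ => (z - z₀) ^ n • (1 : H →L[ℂ] H)) z₀ := by
  fun_prop

lemma InverseHasPole.hasInverseOrder {A : ℂ → H →L[ℂ] H} {z₀ : ℂ} {n : ℕ}
    (hA : AnalyticAt ℂ A z₀) (h : InverseHasPole A z₀ n) : HasInverseOrder A z₀ n := by
  obtain ⟨-, hunit, hmer, hord⟩ := h
  obtain ⟨g, hg, hg0, hgA⟩ := (meromorphicOrderAt_eq_int_iff hmer).1 hord
  have key : ∀ᶠ z in 𝓝[≠] z₀, g z = (z - z₀) ^ n • Ring.inverse (A z) := by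
    filter_upwards [hgA, eventually_ne_nhdsNE z₀] with z hz hne
    rw [hz, smul_smul, zpow_neg, zpow_natCast, mul_inv_cancel₀ (pow_ne_zero _ hne), one_smul]
  refine ⟨g, hg, hg0, ?_, ?_⟩
  · refine eventuallyEq_nhds_of_nhdsNE (hA.mul hg).continuousAt
      (continuousAt_sub_pow_smul_one z₀ n) ?_
    filter_upwards [key, hunit] with z hz hu
    rw [hz, mul_smul_comm, Ring.mul_inverse_cancel _ hu]
  · refine eventuallyEq_nhds_of_nhdsNE (hg.mul hA).continuousAt
      (continuousAt_sub_pow_smul_one z₀ n) ?_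
    filter_upwards [key, hunit] with z hz hu
    rw [hz, smul_mul_assoc, Ring.inverse_mul_cancel _ hu]

lemma HasInverseOrder.isUnit {A : ℂ → H →L[ℂ] H} {z₀ : ℂ} (h : HasInverseOrder A z₀ 0) :
    IsUnit (A z₀) := by
  obtain ⟨g, -, -, h1, h2⟩ := h
  have h1 := h1.self_of_nhds
  have h2 := h2.self_of_nhds
  rw [pow_zero, one_smul] at h1 h2
  exact ⟨⟨A z₀, g z₀, h1, h2⟩, rfl⟩

lemma HasInverseOrder.ker_ne_bot {A : ℂ → H →L[ℂ] H} {z₀ : ℂ} {n : ℕ}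
    (h : HasInverseOrder A z₀ (n + 1)) : LinearMap.ker (A z₀ : H →ₗ[ℂ] H) ≠ ⊥ := by
  obtain ⟨g, -, h0, h1, -⟩ := h
  have h1 := h1.self_of_nhds
  rw [sub_self, zero_pow (Nat.succ_ne_zero n), zero_smul] at h1
  intro hker
  apply h0
  ext x
  have : g z₀ x ∈ LinearMap.ker (A z₀ : H →ₗ[ℂ] H) :=
    congrArg (fun R : H →L[ℂ] H => R x) h1
  rw [hker] at this
  exact this

/-- Dividing by the elementary factor of a projection onto `ker A(z₀)` lowers the order of the pole
of the inverse by exactly one. -/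
lemma HasInverseOrder.peel [CompleteSpace H] {A : ℂ → H →L[ℂ] H} {z₀ : ℂ} {n : ℕ}
    (hA : AnalyticAt ℂ A z₀) (h : HasInverseOrder A z₀ (n + 1)) {P : H →L[ℂ] H}
    (hP : IsIdempotentElem P)
    (hker : LinearMap.range (P : H →ₗ[ℂ] H) = LinearMap.ker (A z₀ : H →ₗ[ℂ] H)) :
    HasInverseOrder (peel A z₀ P) z₀ n := by
  obtain ⟨g, hg, hg0, h1, h2⟩ := h
  have hP' : P * P = P := hP
  have hAP := mul_eq_zero_of_range_eq_ker hker
  have hPg : P * g z₀ = g z₀ := by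
    refine mul_eq_of_range_eq_ker hP hker ?_
    have := h1.self_of_nhds
    rwa [sub_self, zero_pow (Nat.succ_ne_zero n), zero_smul] at this
  -- the new numerator is `(z - z₀)⁻¹ [Q - (z - z₀) P] g(z)`
  set k : ℂ → H →L[ℂ] H := fun z => (1 - P) * dslope g z₀ z - P * g z with hk
  have hkan : AnalyticAt ℂ k z₀ :=
    (analyticAt_const.mul (analyticAt_dslope hg)).sub (analyticAt_const.mul hg)
  have hkg : ∀ z, (z - z₀) • k z = factor P (z - z₀) * g z := by
    intro z
    simp only [hk, factor, smul_sub, ← mul_smul_comm, sub_smul_dslope, sub_mul, mul_sub, one_mul,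
      hPg, smul_mul_assoc]
    rw [mul_smul_comm]
    abel
  have hkg' : ∀ z, z - z₀ ≠ 0 → k z = (z - z₀)⁻¹ • (factor P (z - z₀) * g z) := by
    intro z hz
    rw [← hkg, smul_smul, inv_mul_cancel₀ hz, one_smul]
  have hB := analyticAt_peel hA P
  refine ⟨k, hkan, ?_, ?_, ?_⟩
  · intro hk0
    apply hg0
    have : P * k z₀ = -(P * g z₀) := by
      simp only [hk, mul_sub, ← mul_assoc, mul_one, hP', sub_self, zero_mul, zero_sub]
    rw [hk0, mul_zero, hPg] at this
    simpa using this.symm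
  · refine eventuallyEq_nhds_of_nhdsNE (hB.mul hkan).continuousAt
      (continuousAt_sub_pow_smul_one z₀ n) ?_
    filter_upwards [eventually_ne_nhdsNE z₀, h1.filter_mono nhdsWithin_le_nhds] with z hz h1z
    rw [hkg' z hz, mul_smul_comm, ← mul_assoc, peel_mul_factor hP hAP, h1z, smul_smul, pow_succ',
      inv_mul_cancel_left₀ hz]
  · refine eventuallyEq_nhds_of_nhdsNE (hkan.mul hB).continuousAt
      (continuousAt_sub_pow_smul_one z₀ n) ?_
    filter_upwards [eventually_ne_nhdsNE z₀, h2.filter_mono nhdsWithin_le_nhds] with z hz h2z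
    have hBz : HowlandFactorization.peel A z₀ P z = A z * factor P (z - z₀)⁻¹ := by
      rw [← peel_mul_factor hP hAP z, mul_assoc, factor_mul_factor_inv hP hz, mul_one]
    rw [hkg' z hz, hBz, smul_mul_assoc, mul_assoc, ← mul_assoc (g z), h2z, smul_mul_assoc,
      one_mul, mul_smul_comm, factor_mul_factor_inv hP hz, smul_smul, pow_succ',
      inv_mul_cancel_left₀ hz]

end Pole

/-! ### Analytic equivalence and multiplicity -/

section Equivalence

variable {H : Type*} [NormedAddCommGroup H] [InnerProductSpace ℂ H]

/-- Analytic equivalence at `z₀`: `A = E A' G` near `z₀` with `E`, `G` analytic at `z₀` and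
invertible there. -/
def LocallyEquivalent (z₀ : ℂ) (A A' : ℂ → H →L[ℂ] H) : Prop :=
  ∃ E G : ℂ → H →L[ℂ] H, AnalyticAt ℂ E z₀ ∧ AnalyticAt ℂ G z₀ ∧ IsUnit (E z₀) ∧ IsUnit (G z₀) ∧
    ∀ᶠ z in 𝓝 z₀, A z = E z * A' z * G z

lemma LocallyEquivalent.finrank_ker_eq {z₀ : ℂ} {A A' : ℂ → H →L[ℂ] H}
    (h : LocallyEquivalent z₀ A A') :
    Module.finrank ℂ (LinearMap.ker (A z₀ : H →ₗ[ℂ] H)) =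
      Module.finrank ℂ (LinearMap.ker (A' z₀ : H →ₗ[ℂ] H)) := by
  obtain ⟨E, G, -, -, hE, ⟨g, hg⟩, h⟩ := h
  have h := h.self_of_nhds
  let e : H ≃ₗ[ℂ] H := (ContinuousLinearEquiv.unitsEquiv ℂ H g).toLinearEquiv
  have he : ∀ x, e x = G z₀ x := fun x => by rw [← hg]; rfl
  obtain ⟨u, hu⟩ := hE
  have hEinj : ∀ x, E z₀ x = 0 ↔ x = 0 := fun x => by
    rw [← hu]
    exact (ContinuousLinearEquiv.unitsEquiv ℂ H u).map_eq_zero_iff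
  have : LinearMap.ker (A z₀ : H →ₗ[ℂ] H) =
      (LinearMap.ker (A' z₀ : H →ₗ[ℂ] H)).comap (e : H →ₗ[ℂ] H) := by
    ext x
    have h1 : A z₀ x = E z₀ (A' z₀ (G z₀ x)) := congrArg (fun R : H →L[ℂ] H => R x) h
    have h2 : (A z₀ x = 0) ↔ (A' z₀ (e x) = 0) := by rw [h1, hEinj, he]
    exact h2
  rw [this, ← e.symm_symm, ← Submodule.map_equiv_eq_comap_symm]
  exact LinearEquiv.finrank_map_eq e.symm _

variable [CompleteSpace H]

lemma analyticAt_ringInverse {G : ℂ → H →L[ℂ] H} {z₀ : ℂ} (hG : AnalyticAt ℂ G z₀)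
    (hu : IsUnit (G z₀)) : AnalyticAt ℂ (fun z => Ring.inverse (G z)) z₀ := by
  obtain ⟨u, hu⟩ := hu
  have := analyticAt_inverse (𝕜 := ℂ) u
  rw [hu] at this
  exact this.comp hG

lemma eventually_isUnit {G : ℂ → H →L[ℂ] H} {z₀ : ℂ} (hG : ContinuousAt G z₀)
    (hu : IsUnit (G z₀)) : ∀ᶠ z in 𝓝 z₀, IsUnit (G z) :=
  hG.eventually (Units.isOpen.mem_nhds hu)

/-- The conjugate of `G(z)` by elementary factors has a removable singularity at `z₀` as soon as
`G(z₀)` maps `ran P` into `ran P'`. -/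
lemma exists_analyticAt_factor_mul_mul_factor {G : ℂ → H →L[ℂ] H} {z₀ : ℂ}
    (hG : AnalyticAt ℂ G z₀) {P P' : H →L[ℂ] H} (h0 : (1 - P') * G z₀ * P = 0) :
    ∃ K : ℂ → H →L[ℂ] H, AnalyticAt ℂ K z₀ ∧
      ∀ z, z - z₀ ≠ 0 → K z = factor P' (z - z₀) * G z * factor P (z - z₀)⁻¹ := by
  refine ⟨fun z => factor P' (z - z₀) * G z * (1 - P) - (1 - P') * dslope G z₀ z * P
    + P' * G z * P, ?_, fun z hz => ?_⟩
  · have hid : AnalyticAt ℂ (fun z : ℂ => factor P' (z - z₀)) z₀ := by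
      unfold factor
      fun_prop
    have hD := analyticAt_dslope hG
    fun_prop
  · beta_reduce
    have h1 : (1 - P') * dslope G z₀ z * P = (z - z₀)⁻¹ • ((1 - P') * G z * P) := by
      have : (z - z₀) • ((1 - P') * dslope G z₀ z * P) = (1 - P') * G z * P := by
        rw [← smul_mul_assoc, ← mul_smul_comm, sub_smul_dslope, mul_sub, sub_mul, h0, sub_zero]
      rw [← this, smul_smul, inv_mul_cancel₀ hz, one_smul]
    rw [h1]
    have h2 : P' * G z * P = (z - z₀)⁻¹ • ((z - z₀) • (P' * G z * P)) := by
      rw [smul_smul, inv_mul_cancel₀ hz, one_smul]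
    rw [h2]
    simp only [factor, mul_sub, sub_mul, one_mul, mul_one, smul_mul_assoc, mul_smul_comm, smul_sub]
    abel

/-- Removing from two equivalent families the elementary factors that belong to their kernels
leaves equivalent families. -/
lemma LocallyEquivalent.of_factor {z₀ : ℂ} {A A' B B' : ℂ → H →L[ℂ] H}
    (h : LocallyEquivalent z₀ A A') {P P' : H →L[ℂ] H}
    (hP : IsIdempotentElem P) (hP' : IsIdempotentElem P')
    (hker : LinearMap.range (P : H →ₗ[ℂ] H) = LinearMap.ker (A z₀ : H →ₗ[ℂ] H))
    (hker' : LinearMap.range (P' : H →ₗ[ℂ] H) = LinearMap.ker (A' z₀ : H →ₗ[ℂ] H))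
    (hB : AnalyticAt ℂ B z₀) (hB' : AnalyticAt ℂ B' z₀)
    (hAB : ∀ᶠ z in 𝓝 z₀, A z = B z * factor P (z - z₀))
    (hAB' : ∀ᶠ z in 𝓝 z₀, A' z = B' z * factor P' (z - z₀)) :
    LocallyEquivalent z₀ B B' := by
  obtain ⟨E, G, hE, hG, hEu, hGu, h⟩ := h
  have h0 := h.self_of_nhds
  have hAP := mul_eq_zero_of_range_eq_ker hker
  have hAP' := mul_eq_zero_of_range_eq_ker hker'
  have hGi := analyticAt_ringInverse hG hGu
  have hGGi : G z₀ * Ring.inverse (G z₀) = 1 := Ring.mul_inverse_cancel _ hGu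
  have e1 : (1 - P') * G z₀ * P = 0 := by
    have : P' * (G z₀ * P) = G z₀ * P := by
      refine mul_eq_of_range_eq_ker hP' hker' ?_
      rw [h0, mul_assoc, mul_assoc] at hAP
      rwa [hEu.mul_right_eq_zero] at hAP
    rw [mul_assoc, sub_mul, this, one_mul, sub_self]
  have e2 : (1 - P) * Ring.inverse (G z₀) * P' = 0 := by
    have : P * (Ring.inverse (G z₀) * P') = Ring.inverse (G z₀) * P' := by
      refine mul_eq_of_range_eq_ker hP hker ?_
      rw [h0, mul_assoc, mul_assoc, ← mul_assoc (G z₀), hGGi, one_mul, hAP', mul_zero]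
    rw [mul_assoc, sub_mul, this, one_mul, sub_self]
  obtain ⟨K, hK, hKz⟩ := exists_analyticAt_factor_mul_mul_factor hG e1
  obtain ⟨L, hL, hLz⟩ := exists_analyticAt_factor_mul_mul_factor hGi e2
  have hGe : ∀ᶠ z in 𝓝[≠] z₀, IsUnit (G z) :=
    (eventually_isUnit hG.continuousAt hGu).filter_mono nhdsWithin_le_nhds
  have hKL : K z₀ * L z₀ = 1 := by
    refine (eventuallyEq_nhds_of_nhdsNE (g := fun _ => 1) (hK.mul hL).continuousAt
      continuousAt_const ?_).self_of_nhds
    filter_upwards [eventually_ne_nhdsNE z₀, hGe] with z hz hu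
    rw [Pi.mul_apply, hKz z hz, hLz z hz]
    calc factor P' (z - z₀) * G z * factor P (z - z₀)⁻¹ *
          (factor P (z - z₀) * Ring.inverse (G z) * factor P' (z - z₀)⁻¹)
        = factor P' (z - z₀) * (G z * ((factor P (z - z₀)⁻¹ * factor P (z - z₀)) *
            Ring.inverse (G z))) * factor P' (z - z₀)⁻¹ := by simp only [mul_assoc]
      _ = 1 := by
        rw [factor_inv_mul_factor hP hz, one_mul, Ring.mul_inverse_cancel _ hu, mul_one,
          factor_mul_factor_inv hP' hz]
  have hLK : L z₀ * K z₀ = 1 := by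
    refine (eventuallyEq_nhds_of_nhdsNE (g := fun _ => 1) (hL.mul hK).continuousAt
      continuousAt_const ?_).self_of_nhds
    filter_upwards [eventually_ne_nhdsNE z₀, hGe] with z hz hu
    rw [Pi.mul_apply, hKz z hz, hLz z hz]
    calc factor P (z - z₀) * Ring.inverse (G z) * factor P' (z - z₀)⁻¹ *
          (factor P' (z - z₀) * G z * factor P (z - z₀)⁻¹)
        = factor P (z - z₀) * (Ring.inverse (G z) * ((factor P' (z - z₀)⁻¹ *
            factor P' (z - z₀)) * G z)) * factor P (z - z₀)⁻¹ := by simp only [mul_assoc]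
      _ = 1 := by
        rw [factor_inv_mul_factor hP' hz, one_mul, Ring.inverse_mul_cancel _ hu, mul_one,
          factor_mul_factor_inv hP hz]
  refine ⟨E, K, hE, hK, hEu, ⟨⟨K z₀, L z₀, hKL, hLK⟩, rfl⟩, ?_⟩
  refine eventuallyEq_nhds_of_nhdsNE hB.continuousAt ((hE.mul hB').mul hK).continuousAt ?_
  filter_upwards [eventually_ne_nhdsNE z₀, h.filter_mono nhdsWithin_le_nhds,
    hAB.filter_mono nhdsWithin_le_nhds, hAB'.filter_mono nhdsWithin_le_nhds] with z hz h1 h2 h3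
  calc B z = B z * factor P (z - z₀) * factor P (z - z₀)⁻¹ := by
        rw [mul_assoc, factor_mul_factor_inv hP hz, mul_one]
    _ = E z * B' z * K z := by
        rw [← h2, h1, h3, hKz z hz]
        simp only [mul_assoc]

/-- `A` has multiplicity `m` at `z₀` if it becomes invertible at `z₀` after successive divisions by
elementary factors of projections onto the current kernels, the ranks of which add up to `m`. -/
inductive HasMultiplicity (z₀ : ℂ) : (ℂ → H →L[ℂ] H) → ℕ → Prop
  | unit (A : ℂ → H →L[ℂ] H) (hu : IsUnit (A z₀)) : HasMultiplicity z₀ A 0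
  | step (A B : ℂ → H →L[ℂ] H) (P : H →L[ℂ] H) (m : ℕ) (hB : AnalyticAt ℂ B z₀)
      (hP : IsIdempotentElem P)
      (hker : LinearMap.range (P : H →ₗ[ℂ] H) = LinearMap.ker (A z₀ : H →ₗ[ℂ] H))
      (hAB : ∀ᶠ z in 𝓝 z₀, A z = B z * factor P (z - z₀))
      (h : HasMultiplicity z₀ B m) : HasMultiplicity z₀ A (rangeDim P + m)

end Equivalence

/-! ### Blocks and their determinants -/

section Compression

variable {H : Type*} [NormedAddCommGroup H] [InnerProductSpace ℂ H]

/-- The block of `T` acting in the range of the projection `R`. -/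
noncomputable def compression (R T : H →L[ℂ] H) :
    LinearMap.range (R : H →ₗ[ℂ] H) →ₗ[ℂ] LinearMap.range (R : H →ₗ[ℂ] H) :=
  (R : H →ₗ[ℂ] H).rangeRestrict ∘ₗ (T : H →ₗ[ℂ] H) ∘ₗ
    (LinearMap.range (R : H →ₗ[ℂ] H)).subtype

lemma apply_eq_self_of_mem_range {R : H →L[ℂ] H} (hR : IsIdempotentElem R) {x : H}
    (hx : x ∈ LinearMap.range (R : H →ₗ[ℂ] H)) : R x = x := by
  obtain ⟨y, rfl⟩ := hx
  exact congrArg (fun S : H →L[ℂ] H => S y) hR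

lemma coe_compression_apply (R T : H →L[ℂ] H) (x : LinearMap.range (R : H →ₗ[ℂ] H)) :
    (compression R T x : H) = R (T x) := rfl

lemma compression_one {R : H →L[ℂ] H} (hR : IsIdempotentElem R) :
    compression R 1 = LinearMap.id := by
  ext x
  exact apply_eq_self_of_mem_range hR x.2

lemma compression_mul {R : H →L[ℂ] H} (hR : IsIdempotentElem R) (S : H →L[ℂ] H) {T : H →L[ℂ] H}
    (hT : T * R = R * T) : compression R (S * T) = compression R S ∘ₗ compression R T := by
  ext x
  have h1 : R (T x) = T x := by
    have : T (R x) = R (T x) := congrArg (fun S : H →L[ℂ] H => S x) hT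
    rw [← this, apply_eq_self_of_mem_range hR x.2]
  show R (S (T x)) = R (S (R (T x)))
  rw [h1]

lemma det_compression_ne_zero {R T : H →L[ℂ] H} (hR : IsIdempotentElem R)
    (hT : T * R = R * T) (hu : IsUnit T) : LinearMap.det (compression R T) ≠ 0 := by
  obtain ⟨u, rfl⟩ := hu
  have h : compression R (↑u⁻¹ : H →L[ℂ] H) ∘ₗ compression R (u : H →L[ℂ] H) = LinearMap.id := by
    rw [← compression_mul hR _ hT, Units.inv_mul, compression_one hR]
  intro h0
  have := congrArg LinearMap.det h
  rw [LinearMap.det_comp, h0, mul_zero, LinearMap.det_id] at this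
  exact zero_ne_one this

lemma analyticAt_det_compression {R : H →L[ℂ] H} (hf : IsFiniteRank R) {T : ℂ → H →L[ℂ] H}
    {z₀ : ℂ} (hT : AnalyticAt ℂ T z₀) :
    AnalyticAt ℂ (fun z => LinearMap.det (compression R (T z))) z₀ := by
  have : FiniteDimensional ℂ (LinearMap.range (R : H →ₗ[ℂ] H)) := hf
  set b := Module.finBasis ℂ (LinearMap.range (R : H →ₗ[ℂ] H))
  have h : (fun z => LinearMap.det (compression R (T z))) = fun z =>
      ∑ σ : Equiv.Perm (Fin (Module.finrank ℂ (LinearMap.range (R : H →ₗ[ℂ] H)))),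
        ((Equiv.Perm.sign σ : ℤ) : ℂ) *
          ∏ i, LinearMap.toMatrix b b (compression R (T z)) (σ i) i := by
    funext z
    rw [← LinearMap.det_toMatrix b, Matrix.det_apply']
  rw [h]
  refine Finset.analyticAt_fun_sum _ fun σ _ => analyticAt_const.mul
    (Finset.analyticAt_fun_prod _ fun i _ => ?_)
  simp only [LinearMap.toMatrix_apply]
  have hR : ∀ x, R x ∈ LinearMap.range (R : H →ₗ[ℂ] H) := fun x => LinearMap.mem_range_self _ x
  let ℓ : H →L[ℂ] ℂ := (LinearMap.toContinuousLinearMap (b.coord (σ i))) ∘L (R.codRestrict _ hR)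
  let ev : (H →L[ℂ] H) →L[ℂ] ℂ := ℓ ∘L (ContinuousLinearMap.apply ℂ H (b i : H))
  exact (ev.analyticAt _).comp hT

/-- `det (Q - w P) = (-w)ᵖ` for a projection `P` of rank `p`. -/
lemma det_one_sub_sub_smul {V : Type*} [AddCommGroup V] [Module ℂ V] [FiniteDimensional ℂ V]
    {p : V →ₗ[ℂ] V} (hp : IsIdempotentElem p) (w : ℂ) :
    LinearMap.det (1 - p - w • p) = (-w) ^ Module.finrank ℂ (LinearMap.range p) := by
  have hpx : ∀ x, p (p x) = p x := fun x => congrArg (fun S : V →ₗ[ℂ] V => S x) hp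
  have hinv : LinearMap.range p ≤ (LinearMap.range p).comap (1 - p - w • p) := by
    rintro _ ⟨x, rfl⟩
    refine ⟨-w • x, ?_⟩
    simp [hpx]
  rw [LinearMap.det_eq_det_mul_det _ _ hinv]
  have h1 : LinearMap.restrict (p := LinearMap.range p) (q := LinearMap.range p)
      (1 - p - w • p) hinv = (-w) • LinearMap.id := by
    ext ⟨_, x, rfl⟩
    simp [hpx]
  have h2 : (LinearMap.range p).mapQ (LinearMap.range p) (1 - p - w • p) hinv = LinearMap.id := by
    ext x
    simp only [LinearMap.comp_apply, Submodule.mkQ_apply, Submodule.mapQ_apply, LinearMap.id_apply]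
    rw [Submodule.Quotient.eq]
    refine ⟨-x - w • x, ?_⟩
    simp
    abel
  rw [h1, h2, LinearMap.det_smul, LinearMap.det_id, LinearMap.det_id, mul_one, mul_one]

lemma det_compression_factor {R P : H →L[ℂ] H} (hR : IsIdempotentElem R) (hf : IsFiniteRank R)
    (hP : IsIdempotentElem P) (hRP : R * P = P) (w : ℂ) :
    LinearMap.det (compression R (factor P w)) = (-w) ^ rangeDim P := by
  have : FiniteDimensional ℂ (LinearMap.range (R : H →ₗ[ℂ] H)) := hf
  have hRPx : ∀ x, R (P x) = P x := fun x => congrArg (fun S : H →L[ℂ] H => S x) hRP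
  have hPx : ∀ x, P (P x) = P x := fun x => congrArg (fun S : H →L[ℂ] H => S x) hP
  have h1 : compression R (factor P w) = 1 - compression R P - w • compression R P := by
    ext x
    have := apply_eq_self_of_mem_range hR x.2
    simp [coe_compression_apply, factor, this]
  have h2 : IsIdempotentElem (compression R P) := by
    ext x
    show R (P (R (P x))) = R (P x)
    rw [hRPx, hRPx, hPx]
  rw [h1, det_one_sub_sub_smul h2]
  congr 1
  have h3 : (LinearMap.range (compression R P)).map
      (LinearMap.range (R : H →ₗ[ℂ] H)).subtype = LinearMap.range (P : H →ₗ[ℂ] H) := by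
    ext y
    constructor
    · rintro ⟨_, ⟨x, rfl⟩, rfl⟩
      exact ⟨x, (hRPx x).symm⟩
    · rintro ⟨x, rfl⟩
      have hmem : P x ∈ LinearMap.range (R : H →ₗ[ℂ] H) := ⟨P x, hRPx x⟩
      refine ⟨⟨P x, hmem⟩, ⟨⟨P x, hmem⟩, Subtype.ext ?_⟩, rfl⟩
      show R (P (P x)) = P x
      rw [hPx, hRPx]
  rw [rangeDim, ← h3]
  exact (LinearEquiv.finrank_eq (Submodule.equivMapOfInjective _
    (Submodule.injective_subtype _) _))

end Compression

/-! ### The multiplicity as the order of a determinant -/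

section Order

variable {H : Type*} [NormedAddCommGroup H] [InnerProductSpace ℂ H] [CompleteSpace H]

lemma analyticOrderAt_neg_sub_pow (z₀ : ℂ) (p : ℕ) :
    analyticOrderAt (fun z : ℂ => (-(z - z₀)) ^ p) z₀ = p := by
  rw [AnalyticAt.analyticOrderAt_eq_natCast (by fun_prop)]
  refine ⟨fun _ => (-1) ^ p, analyticAt_const, pow_ne_zero _ (by norm_num), ?_⟩
  refine Eventually.of_forall fun z => ?_
  rw [smul_eq_mul, ← mul_pow]
  ring

/-- The multiplicity is an invariant of analytic equivalence, and for a family that is the identity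
on a complement of a finite-dimensional space it is the order of the zero of the determinant. -/
theorem HasMultiplicity.analyticOrderAt_det {z₀ : ℂ} {A : ℂ → H →L[ℂ] H} {m : ℕ}
    (h : HasMultiplicity z₀ A m) {R : H →L[ℂ] H} (hR : IsIdempotentElem R) (hf : IsFiniteRank R)
    {A' : ℂ → H →L[ℂ] H} (hA' : AnalyticAt ℂ A' z₀)
    (hcomm : ∀ᶠ z in 𝓝 z₀, A' z * R = R * A' z)
    (hone : ∀ᶠ z in 𝓝 z₀, A' z * (1 - R) = 1 - R) (heq : LocallyEquivalent z₀ A A') :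
    analyticOrderAt (fun z => LinearMap.det (compression R (A' z))) z₀ = m := by
  induction h generalizing A' with
  | unit A hu =>
    rw [Nat.cast_zero, (analyticAt_det_compression hf hA').analyticOrderAt_eq_zero]
    refine det_compression_ne_zero hR hcomm.self_of_nhds ?_
    obtain ⟨E, G, -, -, ⟨e, he⟩, ⟨g, hg⟩, h⟩ := heq
    have h := h.self_of_nhds
    rw [← he, ← hg] at h
    have : A' z₀ = ↑e⁻¹ * A z₀ * ↑g⁻¹ := by
      rw [h, mul_assoc, mul_assoc, Units.mul_inv, mul_one, Units.inv_mul_cancel_left]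
    rw [this]
    exact (e⁻¹.isUnit.mul hu).mul g⁻¹.isUnit
  | step A B P m hB hP hker hAB h ih =>
    have hR' : R * R = R := hR
    -- the kernel of `A'(z₀)` lies in the range of `R`
    have hkerR : ∀ x ∈ LinearMap.ker (A' z₀ : H →ₗ[ℂ] H), R x = x := by
      intro x hx
      have hx : A' z₀ x = 0 := hx
      have h1 : A' z₀ (R x) = R (A' z₀ x) :=
        congrArg (fun S : H →L[ℂ] H => S x) hcomm.self_of_nhds
      have h2 : A' z₀ (x - R x) = x - R x :=
        congrArg (fun S : H →L[ℂ] H => S x) hone.self_of_nhds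
      rw [map_sub, h1, hx, map_zero, sub_zero] at h2
      exact (sub_eq_zero.1 h2.symm).symm
    have hle : LinearMap.ker (A' z₀ : H →ₗ[ℂ] H) ≤ LinearMap.range (R : H →ₗ[ℂ] H) :=
      fun x hx => ⟨x, hkerR x hx⟩
    have : FiniteDimensional ℂ (LinearMap.range (R : H →ₗ[ℂ] H)) := hf
    have : FiniteDimensional ℂ (LinearMap.ker (A' z₀ : H →ₗ[ℂ] H)) :=
      Submodule.finiteDimensional_of_le hle
    set M := LinearMap.ker (A' z₀ : H →ₗ[ℂ] H) with hM
    -- a projection onto the kernel that respects the decomposition defined by `R`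
    set P' : H →L[ℂ] H := M.starProjection * R with hP'def
    have hRS : R * M.starProjection = M.starProjection := by
      ext x
      exact hkerR _ (Submodule.starProjection_apply_mem M x)
    have hRP' : R * P' = P' := by rw [hP'def, ← mul_assoc, hRS]
    have hP'R : P' * R = P' := by rw [hP'def, mul_assoc, hR']
    have hP' : IsIdempotentElem P' := by
      show M.starProjection * R * (M.starProjection * R) = M.starProjection * R
      rw [mul_assoc, ← mul_assoc R, hRS, ← mul_assoc]
      rw [show M.starProjection * M.starProjection = M.starProjection from
        M.isIdempotentElem_starProjection]
    have hker' : LinearMap.range (P' : H →ₗ[ℂ] H) = M := by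
      apply le_antisymm
      · rintro _ ⟨x, rfl⟩
        exact Submodule.starProjection_apply_mem M (R x)
      · intro x hx
        refine ⟨x, ?_⟩
        show M.starProjection (R x) = x
        rw [hkerR x hx]
        exact Submodule.starProjection_eq_self_iff.2 hx
    have hAP' : A' z₀ * P' = 0 := mul_eq_zero_of_range_eq_ker hker'
    have hfac := fun z => peel_mul_factor hP' hAP' z
    have hB' : AnalyticAt ℂ (peel A' z₀ P') z₀ := analyticAt_peel hA' P'
    have hcommf : ∀ w, factor P' w * R = R * factor P' w := by
      intro w
      simp only [factor, sub_mul, mul_sub, one_mul, mul_one, smul_mul_assoc, mul_smul_comm, hP'R,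
        hRP']
    have hcommB : ∀ᶠ z in 𝓝 z₀, peel A' z₀ P' z * R = R * peel A' z₀ P' z := by
      refine eventuallyEq_nhds_of_nhdsNE (hB'.mul analyticAt_const).continuousAt
        (analyticAt_const.mul hB').continuousAt ?_
      filter_upwards [eventually_ne_nhdsNE z₀, hcomm.filter_mono nhdsWithin_le_nhds] with z hz hc
      have hBz : peel A' z₀ P' z = A' z * factor P' (z - z₀)⁻¹ := by
        rw [← hfac z, mul_assoc, factor_mul_factor_inv hP' hz, mul_one]
      rw [hBz, mul_assoc, hcommf, ← mul_assoc, hc, mul_assoc]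
    have honeB : ∀ᶠ z in 𝓝 z₀, peel A' z₀ P' z * (1 - R) = 1 - R := by
      filter_upwards [hone] with z hz
      have h1 : P' * (1 - R) = 0 := by rw [mul_sub, hP'R, mul_one, sub_self]
      rw [peel, sub_mul, mul_assoc, mul_assoc, h1, mul_zero, sub_zero, sub_mul, h1, sub_zero,
        one_mul, hz]
    have hdim : rangeDim P' = rangeDim P := by
      rw [rangeDim, rangeDim, hker', hker, heq.finrank_ker_eq]
    have heqB : LocallyEquivalent z₀ B (peel A' z₀ P') :=
      heq.of_factor hP hP' hker hker' hB hB' hAB (Eventually.of_forall fun z => (hfac z).symm)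
    have key : ∀ z, LinearMap.det (compression R (A' z)) =
        LinearMap.det (compression R (peel A' z₀ P' z)) * (-(z - z₀)) ^ rangeDim P := by
      intro z
      rw [← hfac z, compression_mul hR _ (hcommf _), LinearMap.det_comp,
        det_compression_factor hR hf hP' hRP', hdim]
    have hmul := analyticOrderAt_mul (analyticAt_det_compression hf hB')
      (show AnalyticAt ℂ (fun z : ℂ => (-(z - z₀)) ^ rangeDim P) z₀ by fun_prop)
    have hfun : (fun z => LinearMap.det (compression R (A' z))) =
        (fun z => LinearMap.det (compression R (peel A' z₀ P' z))) *
          fun z => (-(z - z₀)) ^ rangeDim P := funext key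
    rw [hfun, hmul, ih hB' hcommB honeB heqB, analyticOrderAt_neg_sub_pow, Nat.cast_add, add_comm]

end Order

/-! ### Circle integrals in Banach algebras -/

section CircleIntegral

variable {𝔸 : Type*} [NormedRing 𝔸] [NormedAlgebra ℂ 𝔸] [CompleteSpace 𝔸]

lemma mul_circleIntegral (a : 𝔸) {f : ℂ → 𝔸} {c : ℂ} {r : ℝ} (hf : CircleIntegrable f c r) :
    a * circleIntegral f c r = circleIntegral (fun ζ => a * f ζ) c r := by
  have := (ContinuousLinearMap.mul ℂ 𝔸 a).intervalIntegral_comp_comm hf.out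
  simp only [circleIntegral]
  rw [← ContinuousLinearMap.mul_apply' ℂ 𝔸, ← this]
  simp

lemma circleIntegral_mul (a : 𝔸) {f : ℂ → 𝔸} {c : ℂ} {r : ℝ} (hf : CircleIntegrable f c r) :
    circleIntegral f c r * a = circleIntegral (fun ζ => f ζ * a) c r := by
  have := ((ContinuousLinearMap.mul ℂ 𝔸).flip a).intervalIntegral_comp_comm hf.out
  simp only [circleIntegral]
  rw [← ContinuousLinearMap.mul_apply' ℂ 𝔸, ← ContinuousLinearMap.flip_apply, ← this]
  simp

omit [CompleteSpace 𝔸] in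
lemma circleIntegral_circleIntegral_swap {f : ℂ → ℂ → 𝔸} {c d : ℂ} {r s : ℝ}
    (hf : Continuous fun p : ℝ × ℝ => f (circleMap c r p.1) (circleMap d s p.2)) :
    circleIntegral (fun ξ => circleIntegral (fun ζ => f ξ ζ) d s) c r =
      circleIntegral (fun ζ => circleIntegral (fun ξ => f ξ ζ) c r) d s := by
  simp only [circleIntegral, ← intervalIntegral.integral_smul]
  rw [MeasureTheory.intervalIntegral_intervalIntegral_swap]
  · exact intervalIntegral.integral_congr fun _ _ => intervalIntegral.integral_congr fun _ _ =>
      smul_comm _ _ _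
  · have hcont : Continuous (Function.uncurry fun x y : ℝ => deriv (circleMap c r) x •
        deriv (circleMap d s) y • f (circleMap c r x) (circleMap d s y)) := by
      simp only [deriv_circleMap, Function.uncurry_def]
      have h1 : Continuous fun p : ℝ × ℝ => circleMap 0 r p.1 * Complex.I :=
        ((continuous_circleMap 0 r).comp continuous_fst).mul continuous_const
      have h2 : Continuous fun p : ℝ × ℝ => circleMap 0 s p.2 * Complex.I :=
        ((continuous_circleMap 0 s).comp continuous_snd).mul continuous_const
      exact h1.smul (h2.smul hf)
    refine (hcont.continuousOn.integrableOn_compact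
      ((isCompact_uIcc (a := 0) (b := 2 * Real.pi)).prod
        (isCompact_uIcc (a := 0) (b := 2 * Real.pi)))).mono_set ?_
    exact Set.prod_mono Set.uIoc_subset_uIcc Set.uIoc_subset_uIcc

end CircleIntegral

/-! ### Resolvents -/

section Resolvent

variable {𝔸 : Type*} [NormedRing 𝔸] [NormedAlgebra ℂ 𝔸]

lemma mul_resolvent_eq {a : 𝔸} {ζ : ℂ} (h : ζ ∈ resolventSet ℂ a) :
    a * resolvent a ζ = ζ • resolvent a ζ - 1 := by
  have : (algebraMap ℂ 𝔸 ζ - a) * resolvent a ζ = 1 := Ring.mul_inverse_cancel _ h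
  rw [sub_mul, Algebra.algebraMap_eq_smul_one, smul_mul_assoc, one_mul, sub_eq_iff_eq_add'] at this
  exact (sub_eq_of_eq_add this).symm

lemma mul_resolvent_comm (a : 𝔸) (ζ : ℂ) : a * resolvent a ζ = resolvent a ζ * a := by
  by_cases h : ζ ∈ resolventSet ℂ a
  · rw [mul_resolvent_eq h]
    have : resolvent a ζ * (algebraMap ℂ 𝔸 ζ - a) = 1 := Ring.inverse_mul_cancel _ h
    rw [mul_sub, Algebra.algebraMap_eq_smul_one, mul_smul_comm, mul_one, sub_eq_iff_eq_add'] at this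
    exact sub_eq_of_eq_add this
  · rw [resolvent, Ring.inverse_non_unit _ h, mul_zero, zero_mul]

lemma resolvent_mul_resolvent {a : 𝔸} {ξ ζ : ℂ} (hξ : ξ ∈ resolventSet ℂ a)
    (hζ : ζ ∈ resolventSet ℂ a) (hne : ξ ≠ ζ) :
    resolvent a ξ * resolvent a ζ = (ξ - ζ)⁻¹ • (resolvent a ζ - resolvent a ξ) := by
  have h1 : resolvent a ξ * (a * resolvent a ζ) = ζ • (resolvent a ξ * resolvent a ζ)
      - resolvent a ξ := by
    rw [mul_resolvent_eq hζ, mul_sub, mul_one, mul_smul_comm]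
  have h2 : resolvent a ξ * (a * resolvent a ζ) = ξ • (resolvent a ξ * resolvent a ζ)
      - resolvent a ζ := by
    rw [← mul_assoc, ← mul_resolvent_comm, mul_resolvent_eq hξ, sub_mul, one_mul, smul_mul_assoc]
  rw [eq_inv_smul_iff₀ (sub_ne_zero.2 hne), sub_smul]
  rw [h1, sub_eq_sub_iff_add_eq_add] at h2
  rw [sub_eq_sub_iff_add_eq_add, add_comm (resolvent a ζ), h2]

lemma continuousOn_resolvent [CompleteSpace 𝔸] (a : 𝔸) :
    ContinuousOn (resolvent a : ℂ → 𝔸) (resolventSet ℂ a) := fun _ h =>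
  (spectrum.hasDerivAt_resolvent_const_left h).continuousAt.continuousWithinAt

lemma circleIntegrable_smul_resolvent [CompleteSpace 𝔸] {a : 𝔸} {r : ℝ} (hr : 0 < r)
    (h : Metric.sphere (0 : ℂ) r ⊆ resolventSet ℂ a) {g : ℂ → ℂ}
    (hg : ContinuousOn g (Metric.sphere 0 r)) :
    CircleIntegrable (fun ζ => g ζ • resolvent a ζ) 0 r :=
  (hg.smul ((continuousOn_resolvent a).mono h)).circleIntegrable hr.le

lemma circleIntegrable_resolvent [CompleteSpace 𝔸] {a : 𝔸} {r : ℝ} (hr : 0 < r)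
    (h : Metric.sphere (0 : ℂ) r ⊆ resolventSet ℂ a) : CircleIntegrable (resolvent a) 0 r :=
  ((continuousOn_resolvent a).mono h).circleIntegrable hr.le

end Resolvent

/-! ### Riesz projections -/

section Riesz

variable {H : Type*} [NormedAddCommGroup H] [InnerProductSpace ℂ H] [CompleteSpace H]
  {T : H →L[ℂ] H} {ε : ℝ}

lemma rieszProjection_comm (hε : 0 < ε) (h : Metric.sphere (0 : ℂ) ε ⊆ resolventSet ℂ T) :
    T * rieszProjection T ε = rieszProjection T ε * T := by
  have hi := circleIntegrable_resolvent hε h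
  rw [rieszProjection, mul_smul_comm, smul_mul_assoc, mul_circleIntegral _ hi,
    circleIntegral_mul _ hi]
  simp only [mul_resolvent_comm]

lemma rieszProjection_eq_of_annulus {r : ℝ} (hr : 0 < r) (hle : r ≤ ε)
    (h : Metric.closedBall (0 : ℂ) ε \ Metric.ball 0 r ⊆ resolventSet ℂ T) :
    rieszProjection T ε = rieszProjection T r := by
  rw [rieszProjection, rieszProjection,
    Complex.circleIntegral_eq_of_differentiable_on_annulus_off_countable hr hle
      Set.countable_empty ((continuousOn_resolvent T).mono h)]
  rintro z ⟨⟨hz1, hz2⟩, -⟩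
  exact (spectrum.hasDerivAt_resolvent_const_left (h ⟨Metric.ball_subset_closedBall hz1,
    fun hz => hz2 (Metric.ball_subset_closedBall hz)⟩)).differentiableAt

lemma exists_annulus (hε : 0 < ε) (h : Metric.sphere (0 : ℂ) ε ⊆ resolventSet ℂ T) :
    ∃ r, ε < r ∧ Metric.closedBall (0 : ℂ) r \ Metric.ball 0 ε ⊆ resolventSet ℂ T := by
  obtain ⟨δ, hδ, hsub⟩ := (isCompact_sphere (0 : ℂ) ε).exists_cthickening_subset_open
    (spectrum.isOpen_resolventSet T) h
  refine ⟨ε + δ, by linarith, ?_⟩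
  rintro z ⟨hz1, hz2⟩
  apply hsub
  rw [mem_closedBall_zero_iff] at hz1
  rw [mem_ball_zero_iff, not_lt] at hz2
  have hz0 : 0 < ‖z‖ := hε.trans_le hz2
  have hz0' : (‖z‖ : ℂ) ≠ 0 := by exact_mod_cast hz0.ne'
  -- the nearest point of the circle is `(ε / |z|) z`
  refine Metric.mem_cthickening_of_dist_le z (((ε / ‖z‖ : ℝ) : ℂ) * z) δ _ ?_ ?_
  · rw [mem_sphere_zero_iff_norm, norm_mul, Complex.norm_real, Real.norm_of_nonneg (by positivity)]
    field_simp
  · have : z - ((ε / ‖z‖ : ℝ) : ℂ) * z = (((‖z‖ - ε) / ‖z‖ : ℝ) : ℂ) * z := by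
      push_cast
      field_simp
    rw [dist_eq_norm, this, norm_mul, Complex.norm_real,
      Real.norm_of_nonneg (div_nonneg (by linarith) hz0.le), div_mul_cancel₀ _ hz0.ne']
    linarith

/-- The Riesz projection is idempotent: multiply the integrals over two concentric circles and use
the resolvent identity. -/
lemma isIdempotentElem_rieszProjection (hε : 0 < ε)
    (h : Metric.sphere (0 : ℂ) ε ⊆ resolventSet ℂ T) :
    IsIdempotentElem (rieszProjection T ε) := by
  obtain ⟨r, hr, hann⟩ := exists_annulus hε h
  have hr0 : 0 < r := hε.trans hr
  have hsr : Metric.sphere (0 : ℂ) r ⊆ resolventSet ℂ T := fun z hz =>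
    hann ⟨Metric.sphere_subset_closedBall hz, fun hz' => by
      rw [mem_ball_zero_iff] at hz'
      rw [mem_sphere_zero_iff_norm] at hz
      linarith⟩
  have hi := circleIntegrable_resolvent hε h
  have hir := circleIntegrable_resolvent hr0 hsr
  have hne : ∀ ξ ∈ Metric.sphere (0 : ℂ) r, ∀ ζ ∈ Metric.closedBall (0 : ℂ) ε, ξ - ζ ≠ 0 := by
    intro ξ hξ ζ hζ h0
    rw [mem_sphere_zero_iff_norm] at hξ
    rw [mem_closedBall_zero_iff, ← sub_eq_zero.1 h0, hξ] at hζ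
    linarith
  -- the inner integral, for a point `ξ` of the outer circle
  have hinner : ∀ ξ ∈ Metric.sphere (0 : ℂ) r,
      resolvent T ξ * circleIntegral (resolvent T) 0 ε =
        circleIntegral (fun ζ => (ξ - ζ)⁻¹ • resolvent T ζ) 0 ε := by
    intro ξ hξ
    have hcont : ContinuousOn (fun ζ => (ξ - ζ)⁻¹) (Metric.closedBall (0 : ℂ) ε) :=
      (continuousOn_const.sub continuousOn_id).inv₀ (hne ξ hξ)
    have hzero : circleIntegral (fun ζ => (ξ - ζ)⁻¹ • resolvent T ξ) 0 ε = 0 := by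
      refine Complex.circleIntegral_eq_zero_of_differentiable_on_off_countable hε.le
        Set.countable_empty (hcont.smul continuousOn_const) ?_
      rintro ζ ⟨hζ, -⟩
      exact ((differentiableAt_const _).sub differentiableAt_id).inv
        (hne ξ hξ ζ (Metric.ball_subset_closedBall hζ)) |>.smul_const _
    rw [mul_circleIntegral _ hi, ← sub_zero (circleIntegral (fun ζ => (ξ - ζ)⁻¹ • resolvent T ζ) 0 ε),
      ← hzero, ← circleIntegral.integral_sub]
    · refine circleIntegral.integral_congr hε.le fun ζ hζ => ?_
      show resolvent T ξ * resolvent T ζ =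
        (ξ - ζ)⁻¹ • resolvent T ζ - (ξ - ζ)⁻¹ • resolvent T ξ
      rw [resolvent_mul_resolvent (hsr hξ) (h hζ)
        (sub_ne_zero.1 (hne ξ hξ ζ (Metric.sphere_subset_closedBall hζ))), smul_sub]
    · exact circleIntegrable_smul_resolvent hε h (hcont.mono Metric.sphere_subset_closedBall)
    · exact ((hcont.mono Metric.sphere_subset_closedBall).smul continuousOn_const).circleIntegrable
        hε.le
  have hswap : circleIntegral (fun ξ => circleIntegral (fun ζ => (ξ - ζ)⁻¹ • resolvent T ζ) 0 ε) 0 r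
      = circleIntegral (fun ζ => circleIntegral (fun ξ => (ξ - ζ)⁻¹ • resolvent T ζ) 0 r) 0 ε := by
    apply circleIntegral_circleIntegral_swap
    have hc1 : Continuous fun p : ℝ × ℝ => (circleMap 0 r p.1 - circleMap 0 ε p.2)⁻¹ := by
      refine Continuous.inv₀ (((continuous_circleMap 0 r).comp continuous_fst).sub
        ((continuous_circleMap 0 ε).comp continuous_snd)) fun p => ?_
      exact hne _ (circleMap_mem_sphere 0 hr0.le _) _
        (Metric.sphere_subset_closedBall (circleMap_mem_sphere 0 hε.le _))
    have hc2 : Continuous fun p : ℝ × ℝ => resolvent T (circleMap 0 ε p.2) :=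
      ((continuousOn_resolvent T).mono h).comp_continuous
        ((continuous_circleMap 0 ε).comp continuous_snd) fun p => circleMap_mem_sphere 0 hε.le _
    exact hc1.smul hc2
  have hprod : circleIntegral (resolvent T) 0 r * circleIntegral (resolvent T) 0 ε =
      (2 * (Real.pi : ℂ) * Complex.I) • circleIntegral (resolvent T) 0 ε := by
    rw [circleIntegral_mul _ hir, circleIntegral.integral_congr hr0.le hinner, hswap,
      ← circleIntegral.integral_smul]
    refine circleIntegral.integral_congr hε.le fun ζ hζ => ?_
    show circleIntegral (fun ξ => (ξ - ζ)⁻¹ • resolvent T ζ) 0 r = _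
    rw [circleIntegral.integral_smul_const, circleIntegral.integral_sub_inv_of_mem_ball]
    rw [mem_sphere_zero_iff_norm] at hζ
    rw [mem_ball_zero_iff]
    linarith
  have hP := rieszProjection_eq_of_annulus hε hr.le hann
  show rieszProjection T ε * rieszProjection T ε = rieszProjection T ε
  nth_rewrite 1 [← hP]
  rw [rieszProjection, rieszProjection, smul_mul_smul_comm, hprod, smul_smul, mul_assoc,
    inv_mul_cancel₀ Complex.two_pi_I_ne_zero, mul_one]

/-- `T` is invertible modulo its Riesz projection: the integral of `ζ⁻¹ (ζ - T)⁻¹` gives an inverse,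
up to sign and the factor `2πi`. -/
lemma exists_mul_eq_one_sub_rieszProjection (hε : 0 < ε)
    (h : Metric.sphere (0 : ℂ) ε ⊆ resolventSet ℂ T) :
    ∃ S : H →L[ℂ] H, T * S = 1 - rieszProjection T ε ∧ S * T = 1 - rieszProjection T ε := by
  have hne : ∀ ζ ∈ Metric.sphere (0 : ℂ) ε, ζ ≠ 0 := fun ζ hζ h0 => by
    rw [mem_sphere_zero_iff_norm, h0, norm_zero] at hζ
    exact hε.ne hζ
  have hg : ContinuousOn (fun ζ : ℂ => ζ⁻¹) (Metric.sphere 0 ε) := continuousOn_id.inv₀ hne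
  have hi := circleIntegrable_smul_resolvent hε h hg
  have hi1 : CircleIntegrable (fun ζ : ℂ => ζ⁻¹ • (1 : H →L[ℂ] H)) 0 ε :=
    (hg.smul continuousOn_const).circleIntegrable hε.le
  have hTS : T * circleIntegral (fun ζ => ζ⁻¹ • resolvent T ζ) 0 ε =
      circleIntegral (resolvent T) 0 ε - (2 * (Real.pi : ℂ) * Complex.I) • 1 := by
    have h1 : circleIntegral (fun ζ : ℂ => ζ⁻¹ • (1 : H →L[ℂ] H)) 0 ε =
        (2 * (Real.pi : ℂ) * Complex.I) • 1 := by
      have := circleIntegral.integral_sub_center_inv 0 hε.ne'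
      simp only [sub_zero] at this
      rw [circleIntegral.integral_smul_const, this]
    rw [mul_circleIntegral _ hi, ← h1, ← circleIntegral.integral_sub
      (circleIntegrable_resolvent hε h) hi1]
    refine circleIntegral.integral_congr hε.le fun ζ hζ => ?_
    show T * ζ⁻¹ • resolvent T ζ = resolvent T ζ - ζ⁻¹ • 1
    rw [mul_smul_comm, mul_resolvent_eq (h hζ), smul_sub, smul_smul, inv_mul_cancel₀ (hne ζ hζ),
      one_smul]
  have hcomm : circleIntegral (fun ζ => ζ⁻¹ • resolvent T ζ) 0 ε * T =
      T * circleIntegral (fun ζ => ζ⁻¹ • resolvent T ζ) 0 ε := by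
    rw [mul_circleIntegral _ hi, circleIntegral_mul _ hi]
    simp only [smul_mul_assoc, mul_smul_comm, mul_resolvent_comm]
  have key : T * (-((2 * (Real.pi : ℂ) * Complex.I)⁻¹ •
      circleIntegral (fun ζ => ζ⁻¹ • resolvent T ζ) 0 ε)) = 1 - rieszProjection T ε := by
    rw [mul_neg, mul_smul_comm, hTS, smul_sub, smul_smul,
      inv_mul_cancel₀ Complex.two_pi_I_ne_zero, one_smul, neg_sub, rieszProjection]
  refine ⟨_, key, ?_⟩
  rw [← key, neg_mul, mul_neg, smul_mul_assoc, mul_smul_comm, hcomm]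

/-- On the complementary subspace `ran (1 - P)` the operator is invertible. -/
lemma isUnit_rieszProjection_add (hε : 0 < ε)
    (h : Metric.sphere (0 : ℂ) ε ⊆ resolventSet ℂ T) :
    IsUnit (rieszProjection T ε + T * (1 - rieszProjection T ε)) := by
  obtain ⟨S, h1, h2⟩ := exists_mul_eq_one_sub_rieszProjection hε h
  have hP : rieszProjection T ε * rieszProjection T ε = rieszProjection T ε :=
    isIdempotentElem_rieszProjection hε h
  have hc := rieszProjection_comm hε h
  set P := rieszProjection T ε
  have hPQ : P * (1 - P) = 0 := by rw [mul_sub, hP, mul_one, sub_self]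
  have hQP : (1 - P) * P = 0 := by rw [sub_mul, hP, one_mul, sub_self]
  have hQQ : (1 - P) * (1 - P) = 1 - P := by rw [mul_sub, hQP, mul_one, sub_zero]
  have hTQ : T * (1 - P) = (1 - P) * T := by rw [mul_sub, sub_mul, hc, mul_one, one_mul]
  refine ⟨⟨P + T * (1 - P), P + (1 - P) * S * (1 - P), ?_, ?_⟩, rfl⟩
  · calc (P + T * (1 - P)) * (P + (1 - P) * S * (1 - P))
        = P * P + P * (1 - P) * S * (1 - P) + T * ((1 - P) * P)
            + T * (1 - P) * (1 - P) * S * (1 - P) := by noncomm_ring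
      _ = P + (1 - P) * (1 - P) * (T * S) * (1 - P) := by
          rw [hP, hPQ, hQP, hTQ, mul_assoc (1 - P) T (1 - P), hTQ]; noncomm_ring
      _ = 1 := by rw [h1, hQQ, hQQ, hQQ]; abel
  · calc (P + (1 - P) * S * (1 - P)) * (P + T * (1 - P))
        = P * P + (1 - P) * S * ((1 - P) * P) + P * (T * (1 - P))
            + (1 - P) * S * ((1 - P) * (T * (1 - P))) := by noncomm_ring
      _ = P + (1 - P) * (S * T) * (1 - P) := by
          rw [hP, hQP, hTQ, ← mul_assoc P, hPQ, ← mul_assoc (1 - P) (1 - P), hQQ, ← hTQ]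
          noncomm_ring
      _ = 1 := by rw [h2, hQQ, hQQ]; abel

end Riesz

/-! ### Riesz projections of Fredholm operators -/

section RieszFiniteRank

variable {H : Type*} [NormedAddCommGroup H] [InnerProductSpace ℂ H] [CompleteSpace H]
  {T : H →L[ℂ] H} {ε : ℝ}

omit [CompleteSpace H] in
lemma exists_isFiniteRank_one_sub_mul {T : H →L[ℂ] H} (hT : T.IsFredholm) :
    ∃ V : H →L[ℂ] H, IsFiniteRank (1 - V * T) := by
  obtain ⟨V, hV⟩ := hT.exists_isQuasiInverse
  refine ⟨V, ?_⟩
  have h := hV.1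
  rw [LinearMap.IsLeftQuasiInverse] at h
  have h := LinearMap.FiniteRangeSetoid.equiv_iff_hasFiniteRange.1 h
  rw [← neg_sub]
  exact (isFiniteRank_iff_hasFiniteRange.2 h).neg

omit [CompleteSpace H] in
lemma isFiniteRank_one_sub_pow_mul_pow {V T : H →L[ℂ] H} (h : IsFiniteRank (1 - V * T)) (n : ℕ) :
    IsFiniteRank (1 - V ^ n * T ^ n) := by
  induction n with
  | zero => simpa using isFiniteRank_zero
  | succ n ih =>
    have : 1 - V ^ (n + 1) * T ^ (n + 1) = (1 - V ^ n * T ^ n) + V ^ n * (1 - V * T) * T ^ n := by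
      rw [pow_succ, pow_succ']
      noncomm_ring
    rw [this]
    exact ih.add ((h.mul_left _).mul_right _)

lemma pow_mul_rieszProjection (hε : 0 < ε) (h : Metric.sphere (0 : ℂ) ε ⊆ resolventSet ℂ T)
    (n : ℕ) : T ^ n * rieszProjection T ε =
      (2 * (Real.pi : ℂ) * Complex.I)⁻¹ • circleIntegral (fun ζ => ζ ^ n • resolvent T ζ) 0 ε := by
  induction n with
  | zero => simp [rieszProjection]
  | succ n ih =>
    have hg : ∀ k : ℕ, ContinuousOn (fun ζ : ℂ => ζ ^ k) (Metric.sphere 0 ε) := fun k =>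
      (continuous_pow k).continuousOn
    have hi := fun k => circleIntegrable_smul_resolvent hε h (hg k)
    have hi1 : CircleIntegrable (fun ζ : ℂ => ζ ^ n • (1 : H →L[ℂ] H)) 0 ε :=
      ((hg n).smul continuousOn_const).circleIntegrable hε.le
    have hzero : circleIntegral (fun ζ : ℂ => ζ ^ n • (1 : H →L[ℂ] H)) 0 ε = 0 :=
      Complex.circleIntegral_eq_zero_of_differentiable_on_off_countable hε.le Set.countable_empty
        (((continuous_pow n).smul continuous_const).continuousOn)
        fun z _ => (differentiableAt_pow n).smul_const _
    rw [pow_succ', mul_assoc, ih, mul_smul_comm, mul_circleIntegral _ (hi n)]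
    congr 1
    rw [← sub_zero (circleIntegral (fun ζ => ζ ^ (n + 1) • resolvent T ζ) 0 ε), ← hzero,
      ← circleIntegral.integral_sub (hi (n + 1)) hi1]
    refine circleIntegral.integral_congr hε.le fun ζ hζ => ?_
    show T * ζ ^ n • resolvent T ζ = ζ ^ (n + 1) • resolvent T ζ - ζ ^ n • 1
    rw [mul_smul_comm, mul_resolvent_eq (h hζ), smul_sub, smul_smul, pow_succ]

/-- The Riesz projection of a Fredholm operator at an isolated point `0` of the spectrum has finite
rank: on its range `T` is quasinilpotent, so if `V` is a quasi-inverse of `T`, then `Vⁿ Tⁿ` is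
small there for large `n`, whereas `1 - Vⁿ Tⁿ` has finite rank. -/
lemma isFiniteRank_rieszProjection (hT : T.IsFredholm) (hε : 0 < ε)
    (h : Metric.closedBall (0 : ℂ) ε ∩ spectrum ℂ T ⊆ {0}) :
    IsFiniteRank (rieszProjection T ε) := by
  have hres : ∀ z : ℂ, z ≠ 0 → ‖z‖ ≤ ε → z ∈ resolventSet ℂ T := by
    intro z hz hzε
    by_contra hcon
    exact hz (h ⟨mem_closedBall_zero_iff.2 hzε, hcon⟩)
  obtain ⟨V, hV⟩ := exists_isFiniteRank_one_sub_mul hT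
  set r : ℝ := min ε (2 * (‖V‖ + 1))⁻¹ with hr
  have hV0 := norm_nonneg V
  have hr0 : 0 < r := lt_min hε (by positivity)
  have hrε : r ≤ ε := min_le_left _ _
  have hVr : ‖V‖ * r ≤ 1 / 2 := by
    calc ‖V‖ * r ≤ ‖V‖ * (2 * (‖V‖ + 1))⁻¹ := by gcongr; exact min_le_right _ _
      _ ≤ 1 / 2 := by
        rw [← div_eq_mul_inv, div_le_div_iff₀ (by positivity) (by norm_num)]
        linarith
  have hsph : Metric.sphere (0 : ℂ) r ⊆ resolventSet ℂ T := by
    intro z hz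
    rw [mem_sphere_zero_iff_norm] at hz
    exact hres z (norm_pos_iff.1 (hz ▸ hr0)) (hz ▸ hrε)
  have hPr : rieszProjection T ε = rieszProjection T r := by
    refine rieszProjection_eq_of_annulus hr0 hrε ?_
    rintro z ⟨hz1, hz2⟩
    rw [mem_ball_zero_iff, not_lt] at hz2
    exact hres z (norm_pos_iff.1 (hr0.trans_le hz2)) (mem_closedBall_zero_iff.1 hz1)
  rw [hPr]
  have hP : rieszProjection T r * rieszProjection T r = rieszProjection T r :=
    isIdempotentElem_rieszProjection hr0 hsph
  obtain ⟨M, hM⟩ := (isCompact_sphere (0 : ℂ) r).exists_bound_of_continuousOn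
    ((continuousOn_resolvent T).mono hsph)
  have hM0 : 0 ≤ M := (norm_nonneg _).trans (hM r (by simp [hr0.le]))
  have hTn : ∀ n : ℕ, ‖T ^ n * rieszProjection T r‖ ≤ r * (r ^ n * M) := by
    intro n
    rw [pow_mul_rieszProjection hr0 hsph]
    refine circleIntegral.norm_two_pi_i_inv_smul_integral_le_of_norm_le_const hr0.le fun z hz => ?_
    rw [norm_smul, norm_pow, mem_sphere_zero_iff_norm.1 hz]
    gcongr
    exact hM z hz
  obtain ⟨n, hn⟩ : ∃ n : ℕ, (1 / 2 : ℝ) ^ (n + 1) * (r * M) < 1 := by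
    have h1 : Tendsto (fun n : ℕ => (1 / 2 : ℝ) ^ (n + 1) * (r * M)) atTop (𝓝 (0 * (r * M))) :=
      (((tendsto_pow_atTop_nhds_zero_of_lt_one (by norm_num) (by norm_num)).comp
        (tendsto_add_atTop_nat 1)).mul_const _)
    rw [zero_mul] at h1
    exact (h1.eventually (gt_mem_nhds one_pos)).exists
  set P := rieszProjection T r
  set X := V ^ (n + 1) * T ^ (n + 1) * P with hX
  have hXn : ‖X‖ < 1 := by
    refine lt_of_le_of_lt ?_ hn
    calc ‖X‖ ≤ ‖V ^ (n + 1)‖ * ‖T ^ (n + 1) * P‖ := by rw [hX, mul_assoc]; exact norm_mul_le _ _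
      _ ≤ ‖V‖ ^ (n + 1) * (r * (r ^ (n + 1) * M)) := by
        gcongr
        · exact norm_pow_le' V (Nat.succ_pos n)
        · exact hTn (n + 1)
      _ = (‖V‖ * r) ^ (n + 1) * (r * M) := by rw [mul_pow]; ring
      _ ≤ (1 / 2 : ℝ) ^ (n + 1) * (r * M) := by gcongr
  obtain ⟨u, hu⟩ := isUnit_one_sub_of_norm_lt_one hXn
  have hXP : X * P = X := by rw [hX, mul_assoc, hP]
  have h1 : (u : H →L[ℂ] H) * P = (1 - V ^ (n + 1) * T ^ (n + 1)) * P := by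
    rw [hu, sub_mul, hXP, sub_mul]
  have h2 : P = (↑u⁻¹ : H →L[ℂ] H) * ((1 - V ^ (n + 1) * T ^ (n + 1)) * P) := by
    rw [← h1, Units.inv_mul_cancel_left]
  rw [h2]
  exact ((isFiniteRank_one_sub_pow_mul_pow hV (n + 1)).mul_right P).mul_left _

end RieszFiniteRank

/-! ### Analytic dependence of the Riesz projection -/

section RieszAnalytic

variable {H : Type*} [NormedAddCommGroup H] [InnerProductSpace ℂ H] [CompleteSpace H]
  {A : ℂ → H →L[ℂ] H} {z₀ : ℂ} {ε : ℝ}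

lemma eventually_sphere_subset_resolventSet (hA : ContinuousAt A z₀)
    (h : Metric.sphere (0 : ℂ) ε ⊆ resolventSet ℂ (A z₀)) :
    ∀ᶠ z in 𝓝 z₀, Metric.sphere (0 : ℂ) ε ⊆ resolventSet ℂ (A z) := by
  refine (isCompact_sphere (0 : ℂ) ε).eventually_forall_of_forall_eventually
    (P := fun z ζ => ζ ∈ resolventSet ℂ (A z)) fun ζ hζ => ?_
  have hc : ContinuousAt (fun p : ℂ × ℂ => algebraMap ℂ (H →L[ℂ] H) p.2 - A p.1) (z₀, ζ) :=
    ((algebraMapCLM ℂ (H →L[ℂ] H)).continuous.comp continuous_snd).continuousAt.sub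
      (hA.comp (x := ((z₀, ζ) : ℂ × ℂ)) continuousAt_fst)
  exact hc.eventually (Units.isOpen.mem_nhds (h hζ))

lemma continuousAt_resolvent_prod {z ζ : ℂ} (hA : ContinuousAt A z)
    (h : ζ ∈ resolventSet ℂ (A z)) :
    ContinuousAt (fun p : ℂ × ℂ => resolvent (A p.1) p.2) (z, ζ) := by
  have hc : ContinuousAt (fun p : ℂ × ℂ => algebraMap ℂ (H →L[ℂ] H) p.2 - A p.1) (z, ζ) :=
    ((algebraMapCLM ℂ (H →L[ℂ] H)).continuous.comp continuous_snd).continuousAt.sub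
      (hA.comp (x := ((z, ζ) : ℂ × ℂ)) continuousAt_fst)
  obtain ⟨u, hu⟩ := h
  have hi := NormedRing.inverse_continuousAt u
  rw [hu] at hi
  exact hi.comp (f := fun p : ℂ × ℂ => algebraMap ℂ (H →L[ℂ] H) p.2 - A p.1) (x := (z, ζ)) hc

lemma differentiableAt_rieszProjection (hε : 0 < ε) (hA : AnalyticAt ℂ A z₀)
    (h : Metric.sphere (0 : ℂ) ε ⊆ resolventSet ℂ (A z₀)) :
    DifferentiableAt ℂ (fun z => rieszProjection (A z) ε) z₀ := by
  let D : ℂ → ℂ → H →L[ℂ] H := fun z ζ => resolvent (A z) ζ * deriv A z * resolvent (A z) ζ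
  have hDc : ∀ ζ ∈ Metric.sphere (0 : ℂ) ε, ContinuousAt (fun p : ℂ × ℂ => D p.1 p.2) (z₀, ζ) := by
    intro ζ hζ
    have hr := continuousAt_resolvent_prod hA.continuousAt (h hζ)
    have hd : ContinuousAt (fun p : ℂ × ℂ => deriv A p.1) (z₀, ζ) :=
      ContinuousAt.comp (f := Prod.fst) (g := deriv A) (x := ((z₀, ζ) : ℂ × ℂ))
        hA.deriv.continuousAt continuousAt_fst
    exact ContinuousAt.mul (ContinuousAt.mul hr hd) hr
  have hRc : ∀ z, Metric.sphere (0 : ℂ) ε ⊆ resolventSet ℂ (A z) →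
      Continuous fun θ => resolvent (A z) (circleMap 0 ε θ) := fun z hz =>
    ((continuousOn_resolvent (A z)).mono hz).comp_continuous (continuous_circleMap 0 ε)
      fun θ => circleMap_mem_sphere 0 hε.le θ
  have hcm : Continuous (deriv (circleMap 0 ε)) := by
    have : deriv (circleMap 0 ε) = fun θ => circleMap 0 ε θ * Complex.I :=
      funext fun θ => deriv_circleMap 0 ε θ
    rw [this]
    exact (continuous_circleMap 0 ε).mul continuous_const
  obtain ⟨C, hC⟩ := (isCompact_sphere (0 : ℂ) ε).exists_bound_of_continuousOn (f := D z₀)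
    ((((continuousOn_resolvent (A z₀)).mono h).mul continuousOn_const).mul
      ((continuousOn_resolvent (A z₀)).mono h))
  have hbound : ∀ᶠ z in 𝓝 z₀, ∀ ζ ∈ Metric.sphere (0 : ℂ) ε, ‖D z ζ‖ < C + 1 := by
    refine (isCompact_sphere (0 : ℂ) ε).eventually_forall_of_forall_eventually
      (P := fun z ζ => ‖D z ζ‖ < C + 1) fun ζ hζ => ?_
    exact (hDc ζ hζ).norm.eventually (gt_mem_nhds (by linarith [hC ζ hζ]))
  have hsph := eventually_sphere_subset_resolventSet hA.continuousAt h
  have hs := (hsph.and hbound).and hA.eventually_analyticAt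
  have key := (intervalIntegral.hasDerivAt_integral_of_dominated_loc_of_deriv_le
    (μ := MeasureTheory.volume) (a := 0) (b := 2 * Real.pi) (x₀ := z₀)
    (F := fun z θ => deriv (circleMap 0 ε) θ • resolvent (A z) (circleMap 0 ε θ))
    (F' := fun z θ => deriv (circleMap 0 ε) θ • D z (circleMap 0 ε θ))
    (bound := fun _ => ε * (C + 1)) (s := {z | _}) hs ?_ ?_ ?_ ?_ ?_ ?_).2
  · exact (key.differentiableAt.const_smul (2 * (Real.pi : ℂ) * Complex.I)⁻¹)
  · filter_upwards [hsph] with z hz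
    exact (hcm.smul (hRc z hz)).aestronglyMeasurable
  · exact (hcm.smul (hRc z₀ h)).intervalIntegrable _ _
  · exact (hcm.smul (((hRc z₀ h).mul continuous_const).mul (hRc z₀ h))).aestronglyMeasurable
  · refine Eventually.of_forall fun θ _ z hz => ?_
    rw [norm_smul, deriv_circleMap, norm_mul, Complex.norm_I, mul_one, norm_circleMap_zero,
      abs_of_pos hε]
    gcongr
    exact (hz.1.2 _ (circleMap_mem_sphere 0 hε.le θ)).le
  · exact intervalIntegrable_const
  · refine Eventually.of_forall fun θ _ z hz => ?_
    have hd := (spectrum.hasFDerivAt_resolvent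
      (hz.1.1 (circleMap_mem_sphere 0 hε.le θ))).comp_hasDerivAt z hz.2.differentiableAt.hasDerivAt
    exact hd.const_smul (deriv (circleMap 0 ε) θ)

lemma analyticAt_rieszProjection (hε : 0 < ε) (hA : AnalyticAt ℂ A z₀)
    (h : Metric.sphere (0 : ℂ) ε ⊆ resolventSet ℂ (A z₀)) :
    AnalyticAt ℂ (fun z => rieszProjection (A z) ε) z₀ := by
  rw [Complex.analyticAt_iff_eventually_differentiableAt]
  filter_upwards [hA.eventually_analyticAt,
    eventually_sphere_subset_resolventSet hA.continuousAt h] with z h1 h2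
  exact differentiableAt_rieszProjection hε h1 h2

end RieszAnalytic

/-! ### Howland's multiplicity -/

section Howland

variable {H : Type*} [NormedAddCommGroup H] [InnerProductSpace ℂ H] [CompleteSpace H]
  {A : ℂ → H →L[ℂ] H} {z₀ : ℂ} {ε : ℝ}

/-- Howland's multiplicity is the multiplicity defined by division by elementary factors: `A` is
equivalent at `z₀` to the family that acts as `F(z)` on `ran P(z₀)` and as the identity on the
complementary subspace. -/
theorem howlandMultiplicity_eq (hA : AnalyticAt ℂ A z₀) (hF : (A z₀).IsFredholm) {m : ℕ}
    (hm : HasMultiplicity z₀ A m) (hε : 0 < ε)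
    (h : Metric.closedBall (0 : ℂ) ε ∩ spectrum ℂ (A z₀) ⊆ {0}) :
    howlandMultiplicity A z₀ ε = m := by
  have hsph : Metric.sphere (0 : ℂ) ε ⊆ resolventSet ℂ (A z₀) := by
    intro z hz
    by_contra hcon
    have h0 : z = 0 := h ⟨Metric.sphere_subset_closedBall hz, hcon⟩
    rw [h0, mem_sphere_zero_iff_norm, norm_zero] at hz
    exact hε.ne hz
  set R := rieszProjection (A z₀) ε with hRdef
  have hR : R * R = R := isIdempotentElem_rieszProjection hε hsph
  have hf : IsFiniteRank R := isFiniteRank_rieszProjection hF hε h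
  set W : ℂ → H →L[ℂ] H := wolfTransform A z₀ ε with hW
  have hWz : ∀ z, W z = R * rieszProjection (A z) ε + (1 - R) * (1 - rieszProjection (A z) ε) :=
    fun z => rfl
  have hWan : AnalyticAt ℂ W z₀ := by
    have hP := analyticAt_rieszProjection hε hA hsph
    exact (analyticAt_const.mul hP).add (analyticAt_const.mul (analyticAt_const.sub hP))
  have hW0 : W z₀ = 1 := by
    rw [hWz, ← hRdef, hR, sub_mul, mul_sub, mul_sub, hR]
    simp
  have hWu : IsUnit (W z₀) := hW0 ▸ isUnit_one
  have hWi := analyticAt_ringInverse hWan hWu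
  set A2 : ℂ → H →L[ℂ] H := fun z => W z * A z * Ring.inverse (W z) with hA2
  have hA2an : AnalyticAt ℂ A2 z₀ := (hWan.mul hA).mul hWi
  have hA20 : A2 z₀ = A z₀ := by
    simp only [hA2, hW0, one_mul, Ring.inverse_one, mul_one]
  -- `W(z)` intertwines `P(z)` and `P(z₀)`
  have hcomm : ∀ᶠ z in 𝓝 z₀, A2 z * R = R * A2 z := by
    filter_upwards [eventually_sphere_subset_resolventSet hA.continuousAt hsph,
      eventually_isUnit hWan.continuousAt hWu] with z hz hu
    have hP : rieszProjection (A z) ε * rieszProjection (A z) ε = rieszProjection (A z) ε :=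
      isIdempotentElem_rieszProjection hε hz
    have hAP := rieszProjection_comm hε hz
    have hWP : W z * rieszProjection (A z) ε = R * W z := by
      rw [hWz]
      set P := rieszProjection (A z) ε
      have e1 : (1 - P) * P = 0 := by rw [sub_mul, hP, one_mul, sub_self]
      have e2 : R * (1 - R) = 0 := by rw [mul_sub, hR, mul_one, sub_self]
      rw [add_mul, mul_add, mul_assoc, hP, mul_assoc, e1, mul_zero, ← mul_assoc, ← mul_assoc, hR,
        e2, zero_mul]
    have hWR : Ring.inverse (W z) * R = rieszProjection (A z) ε * Ring.inverse (W z) := by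
      calc Ring.inverse (W z) * R
          = Ring.inverse (W z) * (R * W z) * Ring.inverse (W z) := by
            rw [mul_assoc, mul_assoc, Ring.mul_inverse_cancel _ hu, mul_one]
        _ = rieszProjection (A z) ε * Ring.inverse (W z) := by
            rw [← hWP, ← mul_assoc, Ring.inverse_mul_cancel _ hu, one_mul]
    calc W z * A z * Ring.inverse (W z) * R
        = W z * (A z * rieszProjection (A z) ε) * Ring.inverse (W z) := by
          rw [mul_assoc _ _ R, hWR]; simp only [mul_assoc]
      _ = R * (W z * A z * Ring.inverse (W z)) := by
          rw [hAP, ← mul_assoc, hWP]; simp only [mul_assoc]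
  set A' : ℂ → H →L[ℂ] H := fun z => A2 z * R + (1 - R) with hA'
  have hA'an : AnalyticAt ℂ A' z₀ := (hA2an.mul analyticAt_const).add analyticAt_const
  have hQR : (1 - R) * R = 0 := by rw [sub_mul, hR, one_mul, sub_self]
  have hRQ : R * (1 - R) = 0 := by rw [mul_sub, hR, mul_one, sub_self]
  have hQQ : (1 - R) * (1 - R) = 1 - R := by rw [mul_sub, hQR, mul_one, sub_zero]
  have hcomm' : ∀ᶠ z in 𝓝 z₀, A' z * R = R * A' z := by
    filter_upwards [hcomm] with z hz
    simp only [hA', add_mul, mul_add, hQR, hRQ, add_zero, ← mul_assoc, ← hz]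
  have hone : ∀ᶠ z in 𝓝 z₀, A' z * (1 - R) = 1 - R := by
    refine Eventually.of_forall fun z => ?_
    simp only [hA', add_mul, mul_assoc, hRQ, mul_zero, zero_add, hQQ]
  have heq : LocallyEquivalent z₀ A A' := by
    refine ⟨fun z => Ring.inverse (W z), fun z => (R + A2 z * (1 - R)) * W z, hWi,
      (analyticAt_const.add (hA2an.mul analyticAt_const)).mul hWan, ?_, ?_, ?_⟩
    · exact hWu.ringInverse
    · beta_reduce
      rw [hA20]
      exact (isUnit_rieszProjection_add hε hsph).mul hWu
    · filter_upwards [hcomm, eventually_isUnit hWan.continuousAt hWu] with z hz hu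
      have h1 : A' z * (R + A2 z * (1 - R)) = A2 z := by
        have hzQ : A2 z * (1 - R) = (1 - R) * A2 z := by
          rw [mul_sub, sub_mul, hz, mul_one, one_mul]
        have e1 : R * (A2 z * (1 - R)) = 0 := by rw [hzQ, ← mul_assoc, hRQ, zero_mul]
        have e2 : (1 - R) * (A2 z * (1 - R)) = A2 z * (1 - R) := by
          rw [hzQ, ← mul_assoc, hQQ]
        simp only [hA', add_mul, mul_add, mul_assoc, hR, e1, e2, hQR, mul_zero, add_zero, zero_add]
        rw [mul_sub, mul_one]
        abel
      calc A z = Ring.inverse (W z) * (W z * A z * Ring.inverse (W z)) * W z := by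
            rw [mul_assoc (W z), Ring.inverse_mul_cancel_left _ _ hu, mul_assoc,
              Ring.inverse_mul_cancel _ hu, mul_one]
        _ = Ring.inverse (W z) * A' z * ((R + A2 z * (1 - R)) * W z) := by
            rw [mul_assoc _ (A' z), ← mul_assoc (A' z), h1]
            simp only [hA2, mul_assoc]
  have hblock : ∀ z, howlandBlock A z₀ ε z = compression R (A' z) := by
    intro z
    ext x
    have hx : R (x : H) = x := apply_eq_self_of_mem_range hR x.2
    have : A' z (x : H) = A2 z (x : H) := by
      show A2 z (R (x : H)) + ((x : H) - R (x : H)) = _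
      rw [hx, sub_self, add_zero]
    rw [coe_compression_apply, this]
    rfl
  rw [howlandMultiplicity]
  simp only [hblock]
  exact hm.analyticOrderAt_det hR hf hA'an hcomm' hone heq

end Howland

/-! ### The factorization -/

section Factorization

variable {H : Type*} [NormedAddCommGroup H] [InnerProductSpace ℂ H] [CompleteSpace H]

/-- The factorization, by induction on the order of the pole: each step divides by the elementary
factor of a projection onto the kernel at `z₀`. -/
theorem exists_factorization {Ω : Set ℂ} (hΩ : IsOpen Ω) {z₀ : ℂ} (hz₀ : z₀ ∈ Ω) (n : ℕ) :
    ∀ A : ℂ → H →L[ℂ] H, AnalyticOnNhd ℂ A Ω →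
      FiniteDimensional ℂ (LinearMap.ker (A z₀ : H →ₗ[ℂ] H)) → HasInverseOrder A z₀ n →
      ∃ (P : Fin n → H →L[ℂ] H) (B : ℂ → H →L[ℂ] H),
        (∀ j, IsIdempotentElem (P j)) ∧
        (∀ z ∈ Ω, A z = B z * reversedProduct P (z - z₀)) ∧
        (∀ j, IsFiniteRank (P j)) ∧
        (∀ j, 1 ≤ rangeDim (P j)) ∧
        (∀ i j, i ≤ j → rangeDim (P j) ≤ rangeDim (P i)) ∧
        (∀ j, rangeDim (P j) ≤ Module.finrank ℂ (LinearMap.ker (A z₀ : H →ₗ[ℂ] H))) ∧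
        (∀ j : Fin n, (j : ℕ) = 0 →
          rangeDim (P j) = Module.finrank ℂ (LinearMap.ker (A z₀ : H →ₗ[ℂ] H))) ∧
        AnalyticOnNhd ℂ B Ω ∧
        (∀ z ∈ Ω, IsFiniteRank (A z - B z)) ∧
        IsUnit (B z₀) ∧
        HasMultiplicity z₀ A (∑ j, rangeDim (P j)) := by
  induction n with
  | zero =>
    intro A hA _ hord
    refine ⟨Fin.elim0, A, fun j => j.elim0, fun z _ => ?_, fun j => j.elim0, fun j => j.elim0,
      fun j => j.elim0, fun j => j.elim0, fun j => j.elim0, hA, fun z _ => ?_, hord.isUnit, ?_⟩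
    · simp [reversedProduct]
    · rw [sub_self]
      exact isFiniteRank_zero
    · simpa using HasMultiplicity.unit A hord.isUnit
  | succ n ih =>
    intro A hA hfd hord
    set M := LinearMap.ker (A z₀ : H →ₗ[ℂ] H) with hM
    set P₁ : H →L[ℂ] H := M.starProjection with hP₁def
    have hP₁ : IsIdempotentElem P₁ := M.isIdempotentElem_starProjection
    have hker : LinearMap.range (P₁ : H →ₗ[ℂ] H) = M := Submodule.range_starProjection M
    have hfin : IsFiniteRank P₁ := by
      rw [IsFiniteRank, hker]
      exact hfd
    have hdim : rangeDim P₁ = Module.finrank ℂ M := by rw [rangeDim, hker]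
    have hpos : 1 ≤ Module.finrank ℂ M := by
      have : Nontrivial M := Submodule.nontrivial_iff_ne_bot.2 hord.ker_ne_bot
      exact Module.finrank_pos
    have hAP := mul_eq_zero_of_range_eq_ker hker
    have hB := analyticOnNhd_peel hΩ hA hz₀ P₁
    have hfac := peel_mul_factor hP₁ hAP
    -- a vector of `ker B(z₀) ∩ ker P₁` lies in `ker A(z₀) = ran P₁`, so `P₁` embeds `ker B(z₀)`
    have hinj : ∀ x, peel A z₀ P₁ z₀ x = 0 → P₁ x = 0 → x = 0 := by
      intro x hx hPx
      have h1 : A z₀ x = peel A z₀ P₁ z₀ (x - P₁ x) := by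
        have := congrArg (fun S : H →L[ℂ] H => S x) (hfac z₀)
        rw [sub_self] at this
        rw [← this]
        simp [factor]
      rw [hPx, sub_zero, hx] at h1
      have h2 : x ∈ M := h1
      rw [← Submodule.starProjection_eq_self_iff.2 h2]
      exact hPx
    let φ : LinearMap.ker (peel A z₀ P₁ z₀ : H →ₗ[ℂ] H) →ₗ[ℂ] M :=
      ((P₁ : H →ₗ[ℂ] H) ∘ₗ (LinearMap.ker (peel A z₀ P₁ z₀ : H →ₗ[ℂ] H)).subtype).codRestrict M
        fun x => Submodule.starProjection_apply_mem M x
    have hφ : Function.Injective φ := by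
      rw [← LinearMap.ker_eq_bot, LinearMap.ker_eq_bot']
      intro x hx
      exact Subtype.ext (hinj x x.2 (congrArg (Subtype.val : M → H) hx))
    have hfdB : FiniteDimensional ℂ (LinearMap.ker (peel A z₀ P₁ z₀ : H →ₗ[ℂ] H)) :=
      FiniteDimensional.of_injective φ hφ
    have hle : Module.finrank ℂ (LinearMap.ker (peel A z₀ P₁ z₀ : H →ₗ[ℂ] H)) ≤
        Module.finrank ℂ M := LinearMap.finrank_le_finrank_of_injective hφ
    obtain ⟨P, B, h1, h2, h3, h4, h5, h6, -, h8, h9, h10, h11⟩ :=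
      ih (peel A z₀ P₁) hB hfdB (hord.peel (hA z₀ hz₀) hP₁ hker)
    refine ⟨Fin.cons P₁ P, B, ?_, ?_, ?_, ?_, ?_, ?_, ?_, h8, ?_, h10, ?_⟩
    · exact Fin.cases hP₁ h1
    · intro z hz
      rw [reversedProduct_cons, ← mul_assoc, ← h2 z hz, hfac]
    · exact Fin.cases hfin h3
    · exact Fin.cases (by simpa only [Fin.cons_zero, hdim] using hpos) h4
    · intro i j
      refine Fin.cases (fun _ => ?_) (fun i => ?_) i
      · refine Fin.cases le_rfl (fun j => ?_) j
        simp only [Fin.cons_zero, Fin.cons_succ, hdim]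
        exact (h6 j).trans hle
      · refine Fin.cases (fun hij => absurd hij (by simp)) (fun j hij => ?_) j
        simp only [Fin.cons_succ]
        exact h5 i j (Fin.succ_le_succ_iff.1 hij)
    · refine Fin.cases (by simp only [Fin.cons_zero, hdim]; exact le_rfl) fun j => ?_
      simp only [Fin.cons_succ]
      exact (h6 j).trans hle
    · refine Fin.cases (fun _ => by simpa only [Fin.cons_zero] using hdim) fun j hj => ?_
      simp at hj
    · intro z hz
      have := (isFiniteRank_sub_peel (A := A) (z₀ := z₀) hfin z).add (h9 z hz)
      rwa [sub_add_sub_cancel] at this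
    · rw [Fin.sum_univ_succ]
      simp only [Fin.cons_zero, Fin.cons_succ]
      exact HasMultiplicity.step A (peel A z₀ P₁) P₁ _ (hB z₀ hz₀) hP₁ hker
        (Eventually.of_forall fun z => (hfac z).symm) h11

end Factorization

end HowlandFactorization

open HowlandFactorization in
theorem theorem3p8 {H : Type*} [NormedAddCommGroup H] [InnerProductSpace ℂ H] [CompleteSpace H]
    (Ω : Set ℂ) (hΩ : IsOpen Ω) (hΩc : IsConnected Ω)
    (A : ℂ → H →L[ℂ] H) (hA : AnalyticOnNhd ℂ A Ω) (hAF : ∀ z ∈ Ω, (A z).IsFredholm)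
    (z₀ : ℂ) (hz₀ : z₀ ∈ Ω) (n₀ : ℕ) (hn₀ : 0 < n₀)
    (hpole : HowlandFactorization.InverseHasPole A z₀ n₀) :
    ∃ (P : Fin n₀ → H →L[ℂ] H) (B : ℂ → H →L[ℂ] H),
      -- the `P j` are projections, and `A` factorizes
      (∀ j, IsIdempotentElem (P j)) ∧
      (∀ z ∈ Ω, A z = B z * HowlandFactorization.reversedProduct P (z - z₀)) ∧
      -- `1 ≤ p_{n₀} ≤ ⋯ ≤ p₁ < ∞`
      (∀ j, HowlandFactorization.IsFiniteRank (P j)) ∧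
      (∀ j, 1 ≤ HowlandFactorization.rangeDim (P j)) ∧
      (∀ i j, i ≤ j →
        HowlandFactorization.rangeDim (P j) ≤ HowlandFactorization.rangeDim (P i)) ∧
      -- properties of the remaining factor
      AnalyticOnNhd ℂ B Ω ∧
      (∀ z ∈ Ω, (B z).IsFredholm) ∧
      (∀ᶠ z in 𝓝 z₀, HowlandFactorization.fredholmIndex (A z) = 0 ∧
        HowlandFactorization.fredholmIndex (B z) = 0) ∧
      (∀ᶠ z in 𝓝 z₀, IsUnit (B z)) ∧
      -- `p₁ = dim ker A(z₀)`
      HowlandFactorization.rangeDim (P ⟨0, hn₀⟩) =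
        Module.finrank ℂ (LinearMap.ker (A z₀ : H →ₗ[ℂ] H)) ∧
      -- the sum of the `p_j` is the multiplicity of `A` at `z₀`, with its lower bounds
      (∀ ε : ℝ, 0 < ε → Metric.closedBall (0 : ℂ) ε ∩ spectrum ℂ (A z₀) ⊆ {0} →
        HowlandFactorization.howlandMultiplicity A z₀ ε =
          ((∑ j, HowlandFactorization.rangeDim (P j) : ℕ) : ℕ∞)) ∧
      Module.finrank ℂ (LinearMap.ker (A z₀ : H →ₗ[ℂ] H)) ≤
        ∑ j, HowlandFactorization.rangeDim (P j) ∧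
      n₀ ≤ ∑ j, HowlandFactorization.rangeDim (P j) ∧
      -- trace ideals
      (∀ z ∈ Ω, HowlandFactorization.IsFiniteRank (1 - A z) ↔
        HowlandFactorization.IsFiniteRank (1 - B z)) ∧
      (∀ p : ENNReal, 1 ≤ p → ∀ z ∈ Ω, HowlandFactorization.IsSchatten p (1 - A z) ↔
        HowlandFactorization.IsSchatten p (1 - B z)) := by
  have hFd := (hAF z₀ hz₀).finite_ker
  obtain ⟨P, B, h1, h2, h3, h4, h5, h6, h7, h8, h9, h10, h11⟩ := exists_factorization hΩ hz₀ n₀ A hA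
    hFd (hpole.hasInverseOrder (hA z₀ hz₀))
  have hBA : ∀ z ∈ Ω, IsFiniteRank ((1 - B z) - (1 - A z)) := fun z hz => by
    rw [sub_sub_sub_cancel_left]
    exact h9 z hz
  have hAB : ∀ z ∈ Ω, IsFiniteRank ((1 - A z) - (1 - B z)) := fun z hz => by
    rw [← neg_sub]
    exact (hBA z hz).neg
  have hunit : ∀ᶠ z in 𝓝 z₀, IsUnit (B z) := eventually_isUnit (h8 z₀ hz₀).continuousAt h10
  have hcard : n₀ ≤ ∑ j, rangeDim (P j) := by
    calc n₀ = ∑ _j : Fin n₀, 1 := by simp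
      _ ≤ ∑ j, rangeDim (P j) := Finset.sum_le_sum fun j _ => h4 j
  refine ⟨P, B, h1, h2, h3, h4, h5, h8, fun z hz => isFredholm_of_isFiniteRank_sub (hAF z hz)
    (h9 z hz), ?_, hunit, h7 _ rfl, ?_, ?_, hcard, ?_, ?_⟩
  · filter_upwards [hunit, hΩ.mem_nhds hz₀] with z hu hz
    refine ⟨fredholmIndex_eq_zero hu (h9 z hz), fredholmIndex_eq_zero hu ?_⟩
    rw [sub_self]
    exact isFiniteRank_zero
  · intro ε hε h
    exact howlandMultiplicity_eq (hA z₀ hz₀) (hAF z₀ hz₀) h11 hε h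
  · rw [← h7 ⟨0, hn₀⟩ rfl]
    exact Finset.single_le_sum (f := fun j => rangeDim (P j)) (fun _ _ => Nat.zero_le _)
      (Finset.mem_univ _)
  · intro z hz
    exact ⟨fun h => h.of_isFiniteRank_sub (hAB z hz), fun h => h.of_isFiniteRank_sub (hBA z hz)⟩
  · intro p _ z hz
    exact isSchatten_iff_of_isFiniteRank_sub (hAB z hz)
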